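/- Let $\mathcal H$ be a finite-dimensional or separable complex Hilbert space and $L$ a finite set of locations. Consider a deterministic quantum program with exit: every $l\in L$ carries a trace-preserving super-operator $\mathcal E_l$ on $\mathcal H$ and a measurement $\{M_{l,0},\dots,M_{l,N}\}$, $\sum_j M_{l,j}^\dagger M_{l,j}=I$; there is a next-location map $f:\{0,\dots,N\}\times L\to L$; and there is an exit location $l_e$ with $\mathcal E_{l_e}=\mathrm{id}$, $\{M_{l_e,j}\}_j=\{I,0,\dots,0\}$ and $f(j,l_e)=l_e$ for all $j$. One step of the program is the super-operator on $\mathcal H\otimes\mathbb C^L$ $$\mathcal E_\pi(\sigma)=\sum_{j=0}^N\sum_{l\in L}M_{l,j}\,\mathcal E_l(\langle l|\sigma|l\rangle)\,M_{l,j}^\dagger\otimes|f(j,l)\rangle\langle f(j,l)| .$$ Let $M_0=I\otimes|l_e\rangle\langle l_e|$, $M_1=I\otimes\sum_{l\ne l_e}|l\rangle\langle l|$, $S=\mathcal E_\pi$, and let $\pi$ be the while-program $\mathbf{while}\ \mathcal M=1\ \mathbf{do}\ S\ \mathbf{od}$ with $\mathcal M=\{M_0,M_1\}$. Let $AP$ be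 the set of projections $\sum_l P_l\otimes|l\rangle\langle l|$ (identified with closed subspaces), write $\sigma\models p$ if $\operatorname{supp}\sigma\subseteq p$, and let $\mathcal D$ be the set of partial density operators on $\mathcal H\otimes\mathbb C^L$ (positive, trace $\le1$). For a program $T$ with denotational semantics $[\![T]\!]$, the triple $\{P\}T\{Q\}$ is true in the sense of partial correctness if $[\![T]\!](\rho)\models Q$ for all $\rho\in\mathcal D$ with $\rho\models P$, and in the sense of total correctness if moreover $\operatorname{tr}[\![T]\!](\rho)=\operatorname{tr}\rho$ for these $\rho$. For $p,q\in AP$ put $r(p,q)=\operatorname{supp}[(M_0\wedge q)+(M_1\wedge p)]$. A function $t:\mathcal D\to\mathbb N$ is an $(r,\epsilon)$-ranking function of the loop if for all $\sigma\in\mathcal D$ with $\sigma\models r$: $[\![S]\!](M_1\sigma M_1)\models r$; $t([\![S]\!](M_1\sigma M_1))\le t(\sigma)$; and $\operatorname{tr}\sigma\ge\epsilon$ implies $t([\![S]\!](M_1\sigma M_1))<t(\sigma)$. Consider the rules $$(\square)\ \frac{\{p\}S\{r(p,q)\}}{\{r(p,q)\}\,\pi\,\{q\}}\qquad(\tilde\lozenge)\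 \frac{\{p\}S\{r(p,q)\}\quad\text{for every }\epsilon>0,\ t_\epsilon\text{ is an }(r(p,q),\epsilon)\text{-ranking function}}{\{r(p,q)\}\,\pi\,\{q\}}$$ each together with the consequence rule for triples (with respect to inclusion of subspaces) and the true triples about the loop-free statement $S$, for assertions in $AP$. For $P,q\in AP$ and a temporal formula $\phi$, say that $\phi$ holds from $P$ if every sequence $\sigma_k=\mathcal E_\pi^k(\sigma_0)$, $\sigma_0=\sum_l\rho_l\otimes|l\rangle\langle l|$ a density operator with $\sigma_0\models P$, satisfies $\phi$; here $\square q$ means $\sigma_k\models q$ for all $k$, and $\tilde\lozenge q$ means that for every $\delta>0$ there is $k$ with $\operatorname{tr}(\sigma_k q)>1-\delta$. Then for all $P,q\in AP$ these proof systems are sound and relatively complete: 1. $\{P\}\pi\{q\}$ is derivable with $(\square)$ if and only if it is true in the sense of partial correctness, if and only if $\square\,(M_1+M_0\wedge q)$ holds from $P$. In particular, if $M_1\le q$, that is, $q=\sum_{l\ne l_e}I\otimes|l\rangle\langle l|+Q\otimes|l_e\rangle\langle l_e|$, then it is derivable if and only if $\square q$ holds from $P$. 2. $\{P\}\pi\{q\}$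 is derivable with $(\tilde\lozenge)$ if and only if it is true in the sense of total correctness, if and only if $\tilde\lozenge\,(M_0\wedge q)$ holds from $P$. In particular, if $q\le M_0$, that is, $q=Q\otimes|l_e\rangle\langle l_e|$, then it is derivable if and only if $\tilde\lozenge q$ holds from $P$. -/

import Mathlib

open scoped InnerProductSpace

noncomputable section

namespace QTLogic

/-! ### Operators, trace, states, support -/

/-- Bounded operators on a Hilbert space. -/
abbrev Op (E : Type*) [NormedAddCommGroup E] [InnerProductSpace ℂ E] := E →L[ℂ] E

section Hilbert

variable (E : Type*) [NormedAddCommGroup E] [InnerProductSpace ℂ E] [CompleteSpace E]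

/-- Index set of an orthonormal (Hilbert) basis of `E`. -/
def basisIndex : Set E := (exists_hilbertBasis ℂ E).choose

/-- An orthonormal (Hilbert) basis of `E`. -/
def onb : HilbertBasis (basisIndex E) ℂ E := (exists_hilbertBasis ℂ E).choose_spec.choose

variable {E}

/-- The trace `∑ᵢ ⟨eᵢ, T eᵢ⟩`. It is only used for products of a positive trace class operator
with a bounded operator, where the sum converges absolutely and does not depend on the basis. -/
def trace (T : Op E) : ℂ := ∑' i, ⟪onb E i, T (onb E i)⟫_ℂ

variable (E) in
/-- `𝒟(E)`: partial density operators, the positive trace class operators of trace at most `1`. -/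
def PartialDensity : Set (Op E) :=
  {ρ | ρ.IsPositive ∧ Summable (fun i => ⟪onb E i, ρ (onb E i)⟫_ℂ) ∧ (trace ρ).re ≤ 1}

/-- The support `{φ | ⟨φ, A φ⟩ = 0}ᗮ` of a positive operator `A`. -/
def supp (A : Op E) : ClosedSubmodule ℂ E :=
  ⟨(Submodule.span ℂ {φ : E | ⟪φ, A φ⟫_ℂ = 0})ᗮ, Submodule.isClosed_orthogonal _⟩

/-- `ρ ⊨ p`: the support of `ρ` is contained in `p`. -/
def Sat (ρ : Op E) (p : ClosedSubmodule ℂ E) : Prop := supp ρ ≤ p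

/-- The orthogonal projection onto a closed subspace. -/
def proj (p : ClosedSubmodule ℂ E) : Op E :=
  haveI : CompleteSpace p.toSubmodule := p.isClosed.completeSpace_coe
  p.toSubmodule.starProjection

/-- `A ρ A†`. -/
def sandwich {F : Type*} [NormedAddCommGroup F] [InnerProductSpace ℂ F] [CompleteSpace F]
    (A : E →L[ℂ] F) (ρ : Op E) : Op F :=
  A ∘L ρ ∘L ContinuousLinearMap.adjoint A

variable (E) in
/-- A trace preserving super-operator in Kraus form. The family of Kraus operators is countable
(finite families are padded by zeros) and `∑ₖ Eₖ† Eₖ = I`, that is,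
`∑ₖ ‖Eₖ ψ‖² = ‖ψ‖²` for all `ψ`. -/
structure Channel where
  kraus : ℕ → Op E
  tracePreserving : ∀ ψ : E, HasSum (fun k => ‖kraus k ψ‖ ^ 2) (‖ψ‖ ^ 2)

/-- `ℰ(ρ) = ∑ₖ Eₖ ρ Eₖ†`. -/
def Channel.apply (C : Channel E) (ρ : Op E) : Op E := ∑' k, sandwich (C.kraus k) ρ

/-! ### Quantum while-programs: operational and denotational semantics -/

variable (E) in
/-- Quantum while-programs: basic statements that apply a super-operator, sequential composition,
and the loop `while M = 1 do S od` guarded by a measurement with operators `M₀`, `M₁`. -/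
inductive QWhile : Type _
  | apply (𝓔 : Op E → Op E) : QWhile
  | seq (S T : QWhile) : QWhile
  | loop (M₀ M₁ : Op E) (S : QWhile) : QWhile

/-- Configurations `⟨S, ρ⟩`; `none` is the termination symbol `↓`. -/
abbrev Config (E : Type*) [NormedAddCommGroup E] [InnerProductSpace ℂ E] [CompleteSpace E] :=
  Option (QWhile E) × Op E

/-- `S ; T` with the convention `↓ ; T = T`. -/
def seqOpt (S : Option (QWhile E)) (T : QWhile E) : QWhile E :=
  match S with
  | none => T
  | some S' => .seq S' T

/-- The transitions leaving `⟨S, ρ⟩`. -/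
def transitions : QWhile E → Op E → Multiset (Config E)
  | .apply 𝓔, ρ => {(none, 𝓔 ρ)}
  | .seq S T, ρ => (transitions S ρ).map fun c => (some (seqOpt c.1 T), c.2)
  | .loop M₀ M₁ S, ρ =>
      {(none, sandwich M₀ ρ), (some (.seq S (.loop M₀ M₁ S)), sandwich M₁ ρ)}

/-- Successor configurations; a terminated configuration has none. -/
def successors : Config E → Multiset (Config E)
  | (none, _) => 0
  | (some S, ρ) => transitions S ρ

/-- Configurations reached by the computations of length `n`, with multiplicity. -/
def reached (c : Config E) : ℕ → Multiset (Config E)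
  | 0 => {c}
  | n + 1 => (reached c n).bind successors

/-- The multiset of the `ρ'` such that `⟨S, ρ⟩` reaches `⟨↓, ρ'⟩` in exactly `n` transitions. -/
def outputs (S : QWhile E) (ρ : Op E) (n : ℕ) : Multiset (Op E) :=
  ((reached (some S, ρ) n).filter fun c => c.1.isNone = true).map Prod.snd

/-- `⟦S⟧(ρ)`, the sum of the multiset of all `ρ'` with `⟨S, ρ⟩ →* ⟨↓, ρ'⟩`. -/
def denote (S : QWhile E) (ρ : Op E) : Op E := ∑' n, (outputs S ρ n).sum

/-- Partial correctness of `{P} S {Q}` in applied quantum Hoare logic. -/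
def ValidPar (S : QWhile E) (P Q : ClosedSubmodule ℂ E) : Prop :=
  ∀ ρ ∈ PartialDensity E, Sat ρ P → Sat (denote S ρ) Q

/-- Total correctness of `{P} S {Q}` in applied quantum Hoare logic. -/
def ValidTot (S : QWhile E) (P Q : ClosedSubmodule ℂ E) : Prop :=
  ∀ ρ ∈ PartialDensity E, Sat ρ P → Sat (denote S ρ) Q ∧ trace (denote S ρ) = trace ρ

/-- `t` is a `(q, ε)`-ranking function of the loop with body `S` and guard operator `M₁`. -/
def IsRanking (S : QWhile E) (M₁ : Op E) (q : ClosedSubmodule ℂ E) (ε : ℝ)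
    (t : Op E → ℕ) : Prop :=
  ∀ σ ∈ PartialDensity E, Sat σ q →
    Sat (denote S (sandwich M₁ σ)) q ∧
    t (denote S (sandwich M₁ σ)) ≤ t σ ∧
    (ε ≤ (trace σ).re → t (denote S (sandwich M₁ σ)) < t σ)

/-! ### Quantum temporal logic -/

variable (E) in
/-- Formulas of quantum temporal logic over closed subspaces. -/
inductive QTL : Type _
  | atom (p : ClosedSubmodule ℂ E) : QTL
  | almostEventually (p : ClosedSubmodule ℂ E) : QTL
  | almostUntil (q p : ClosedSubmodule ℂ E) : QTL
  | and (φ ψ : QTL) : QTL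
  | or (φ ψ : QTL) : QTL
  | next (φ : QTL) : QTL
  | untilF (ψ φ : QTL) : QTL
  | eventually (φ : QTL) : QTL
  | always (φ : QTL) : QTL

/-- `w ⊨ φ` for a sequence of states `w`. -/
def Models : (ℕ → Op E) → QTL E → Prop
  | w, .atom p => Sat (w 0) p
  | w, .almostEventually p => ∀ δ : ℝ, 0 < δ → ∃ i, 1 - δ < (trace (w i ∘L proj p)).re
  | w, .almostUntil q p => ∀ δ : ℝ, 0 < δ →
      ∃ i, 1 - δ < (trace (w i ∘L proj p)).re ∧ ∀ k < i, Sat (w k) q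
  | w, .and φ ψ => Models w φ ∧ Models w ψ
  | w, .or φ ψ => Models w φ ∨ Models w ψ
  | w, .next φ => Models (fun n => w (n + 1)) φ
  | w, .untilF ψ φ =>
      ∃ i, Models (fun n => w (n + i)) φ ∧ ∀ k < i, Models (fun n => w (n + k)) ψ
  | w, .eventually φ => ∃ i, Models (fun n => w (n + i)) φ
  | w, .always φ => ∀ i, Models (fun n => w (n + i)) φ

end Hilbert

/-! ### Deterministic quantum programs with exit -/

section Programs

variable (H : Type*) [NormedAddCommGroup H] [InnerProductSpace ℂ H] [CompleteSpace H]
variable (L : Type*) [Fintype L] [DecidableEq L]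

/-- The state space `H ⊗ ℂ^L`, realised as the Hilbert sum of copies of `H` indexed by `L`:
the vector `∑ₗ ψₗ ⊗ |l⟩` is the family `(ψₗ)`. -/
abbrev Joint := PiLp 2 (fun _ : L => H)

variable {H L}

/-- `I_H ⊗ ⟨l|`. -/
def bra (l : L) : Joint H L →L[ℂ] H := PiLp.proj 2 (fun _ : L => H) l

/-- `A ⊗ |k⟩⟨l|`. -/
def ketbra (A : Op H) (k l : L) : Op (Joint H L) :=
  ContinuousLinearMap.adjoint (bra k) ∘L A ∘L bra l

/-- The subspace of the projection `∑ₗ Pₗ ⊗ |l⟩⟨l|`. -/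
def block (P : L → ClosedSubmodule ℂ H) : ClosedSubmodule ℂ (Joint H L) :=
  ⨅ l, (P l).comap (bra l)

variable (H L) in
/-- The atomic propositions `∑ₗ Pₗ ⊗ |l⟩⟨l|`. -/
def AP : Set (ClosedSubmodule ℂ (Joint H L)) := Set.range block

variable (H L) in
/-- The states `∑ₗ ρₗ ⊗ |l⟩⟨l|` of total trace `1`. -/
def States : Set (Op (Joint H L)) :=
  {σ | ∃ ρ : L → Op H, (∀ l, ρ l ∈ PartialDensity H) ∧ ∑ l, trace (ρ l) = 1 ∧
    σ = ∑ l, ketbra (ρ l) l l}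

variable (H L) in
/-- A deterministic quantum program with exit, without its initial data: initial states and
initial locations are described by preconditions. -/
structure ExitProgram where
  /-- measurement outcomes are `0, …, N` -/
  N : ℕ
  /-- the trace preserving super-operator of each location -/
  act : L → Channel H
  /-- the measurement of each location -/
  meas : L → Fin (N + 1) → Op H
  meas_complete : ∀ l, ∑ j, ContinuousLinearMap.adjoint (meas l j) ∘L meas l j = 1
  /-- the next location -/
  goto : Fin (N + 1) → L → L
  /-- the exit location -/
  exit : L
  act_exit : ∀ ρ ∈ PartialDensity H, (act exit).apply ρ = ρ
  meas_exit : ∀ j, meas exit j = if j = 0 then 1 else 0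
  goto_exit : ∀ j, goto j exit = exit

namespace ExitProgram

variable (π : ExitProgram H L)

/-- One step of the program,
`ℰ_π(σ) = ∑ⱼ ∑ₗ (M_{l,j} ℰ_l(σ_l) M_{l,j}†) ⊗ |f(j,l)⟩⟨f(j,l)|`, where `σ_l = ⟨l|σ|l⟩`. -/
def step (σ : Op (Joint H L)) : Op (Joint H L) :=
  ∑ j, ∑ l, ketbra (sandwich (π.meas l j) ((π.act l).apply (sandwich (bra l) σ)))
    (π.goto j l) (π.goto j l)

/-- `M₀ = I_H ⊗ |l_e⟩⟨l_e|` as an operator. -/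
def M₀ : Op (Joint H L) := ketbra 1 π.exit π.exit

/-- `M₁ = I_H ⊗ ∑_{l ≠ l_e} |l⟩⟨l|` as an operator. -/
def M₁ : Op (Joint H L) := ∑ l ∈ Finset.univ.erase π.exit, ketbra 1 l l

/-- The subspace of the projection `M₀`. -/
def exitSpace : ClosedSubmodule ℂ (Joint H L) := block fun l => if l = π.exit then ⊤ else ⊥

/-- The subspace of the projection `M₁`. -/
def runSpace : ClosedSubmodule ℂ (Joint H L) := block fun l => if l = π.exit then ⊥ else ⊤

/-- The loop body `S = ℰ_π`. -/
def body : QWhile (Joint H L) := .apply π.step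

/-- The while-program form `while M = 1 do ℰ_π od`. -/
def whileForm : QWhile (Joint H L) := .loop π.M₀ π.M₁ π.body

/-- `supp[(M₀ ∧ q) + (M₁ ∧ p)]`. -/
def inv (p q : ClosedSubmodule ℂ (Joint H L)) : ClosedSubmodule ℂ (Joint H L) :=
  supp (proj (π.exitSpace ⊓ q) + proj (π.runSpace ⊓ p))

/-- `φ` is valid for the program on inputs satisfying `P`: every admissible sequence
`σ₀, ℰ_π(σ₀), ℰ_π²(σ₀), …` with `σ₀ ⊨ P` satisfies `φ`. -/
def ValidQTL (P : ClosedSubmodule ℂ (Joint H L)) (φ : QTL (Joint H L)) : Prop :=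
  ∀ w : ℕ → Op (Joint H L), w 0 ∈ States H L → Sat (w 0) P →
    (∀ i, w (i + 1) = π.step (w i)) → Models w φ

/-- The proof system for `□`: the invariant rule for the while-program, on top of the true
triples about the loop-free statement `S = ℰ_π` and the consequence rule. -/
inductive ProvesPar : QWhile (Joint H L) → ClosedSubmodule ℂ (Joint H L) →
    ClosedSubmodule ℂ (Joint H L) → Prop
  | basic {p q} : p ∈ AP H L → q ∈ AP H L → ValidPar π.body p q → ProvesPar π.body p q
  | invariant {p q} : p ∈ AP H L → q ∈ AP H L → ProvesPar π.body p (π.inv p q) →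
      ProvesPar π.whileForm (π.inv p q) q
  | conseq {S P P' Q' Q} : P ∈ AP H L → Q ∈ AP H L → P ≤ P' → ProvesPar S P' Q' → Q' ≤ Q →
      ProvesPar S P Q

/-- The proof system for `◇̃`: the rule with ranking functions for the while-program, on top of
the true triples about the loop-free statement `S = ℰ_π` and the consequence rule. -/
inductive ProvesTot : QWhile (Joint H L) → ClosedSubmodule ℂ (Joint H L) →
    ClosedSubmodule ℂ (Joint H L) → Prop
  | basic {p q} : p ∈ AP H L → q ∈ AP H L → ValidTot π.body p q → ProvesTot π.body p q
  | ranking {p q} (t : ℝ → Op (Joint H L) → ℕ) : p ∈ AP H L → q ∈ AP H L →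
      ProvesTot π.body p (π.inv p q) →
      (∀ ε : ℝ, 0 < ε → IsRanking π.body π.M₁ (π.inv p q) ε (t ε)) →
      ProvesTot π.whileForm (π.inv p q) q
  | conseq {S P P' Q' Q} : P ∈ AP H L → Q ∈ AP H L → P ≤ P' → ProvesTot S P' Q' → Q' ≤ Q →
      ProvesTot S P Q

end ExitProgram

end Programs

end QTLogic

end

noncomputable section

namespace QTLogic

open InnerProductSpace ContinuousLinearMap Filter
open scoped ComplexOrder Topology

/-!
A linear, positive, trace non-increasing map `𝓔` on trace class operators turns each correctness
requirement on `𝓔 ρ` (no trace outside `q`, no trace lost) into the vanishing of a nonnegative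
additive functional of `ρ`. Such a functional vanishes at `ρ` iff it vanishes at all `|ψ⟩⟨ψ|` with
`ψ` in the support of `ρ`, and these `ψ` form a closed subspace: the weakest precondition. This
applies to the semantics `∑ₙ M₀ (S M₁)ⁿ ρ (M₁ S)ⁿ M₀` of the loop. As `ℰ_π` only sees the diagonal
blocks of its input, the weakest preconditions of the loop lie in `AP`; being fixed under unfolding
the loop once, they are invariants `r(p, q)`, which gives completeness. For total correctness the
trace of the looping part tends to `0` on the precondition, so the number of rounds until it drops
below `ε` is a ranking function. Finally `ℰ_πⁿ σ` is the sum of the part still looping after `n`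
rounds and the part that has already left, which links the runs of `ℰ_π` to the loop.
-/

/-! ### Supports and projections -/

section Supports

variable {E : Type*} [NormedAddCommGroup E] [InnerProductSpace ℂ E]

theorem mem_supp_iff {A : Op E} {x : E} :
    x ∈ supp A ↔ ∀ u, ⟪u, A u⟫_ℂ = 0 → ⟪u, x⟫_ℂ = 0 := by
  change x ∈ (Submodule.span ℂ {φ : E | ⟪φ, A φ⟫_ℂ = 0})ᗮ ↔ _
  rw [← Submodule.span_singleton_le_iff_mem, ← Submodule.isOrtho_iff_le, Submodule.isOrtho_comm,
    Submodule.isOrtho_span]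
  simp

theorem le_of_forall_norm_eq_one {p q : ClosedSubmodule ℂ E}
    (h : ∀ x ∈ p, ‖x‖ = 1 → x ∈ q) : p ≤ q := by
  intro x hx
  rcases eq_or_ne x 0 with rfl | hx0
  · exact q.toSubmodule.zero_mem
  have hu := h ((‖x‖ : ℂ)⁻¹ • x) (p.toSubmodule.smul_mem _ hx) (norm_smul_inv_norm hx0)
  exact (q.toSubmodule.smul_mem_iff (by simpa using hx0)).1 hu

variable [CompleteSpace E]

theorem supp_le_of_forall_mem_orthogonal {A : Op E} {p : ClosedSubmodule ℂ E}
    (h : ∀ u ∈ p.toSubmoduleᗮ, ⟪u, A u⟫_ℂ = 0) : supp A ≤ p := by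
  have : CompleteSpace p.toSubmodule := p.isClosed.completeSpace_coe
  intro x hx
  change x ∈ p.toSubmodule
  rw [← Submodule.orthogonal_orthogonal p.toSubmodule, Submodule.mem_orthogonal]
  exact fun u hu => mem_supp_iff.1 hx u (h u hu)

theorem inner_proj_self (p : ClosedSubmodule ℂ E) (x : E) :
    ⟪x, proj p x⟫_ℂ = (‖proj p x‖ ^ 2 : ℝ) := by
  have : CompleteSpace p.toSubmodule := p.isClosed.completeSpace_coe
  change ⟪x, p.toSubmodule.starProjection x⟫_ℂ = (‖p.toSubmodule.starProjection x‖ ^ 2 : ℝ)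
  calc ⟪x, p.toSubmodule.starProjection x⟫_ℂ
      = ⟪x, p.toSubmodule.starProjection (p.toSubmodule.starProjection x)⟫_ℂ := by
        rw [Submodule.starProjection_eq_self_iff.2 (Submodule.starProjection_apply_mem _ x)]
    _ = ⟪p.toSubmodule.starProjection x, p.toSubmodule.starProjection x⟫_ℂ :=
        (Submodule.inner_starProjection_left_eq_right _ _ _).symm
    _ = (‖p.toSubmodule.starProjection x‖ ^ 2 : ℝ) := by
        simp only [inner_self_eq_norm_sq_to_K, Complex.coe_algebraMap, Complex.ofReal_pow]

theorem norm_proj_le (p : ClosedSubmodule ℂ E) (x : E) : ‖proj p x‖ ≤ ‖x‖ :=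
  haveI : CompleteSpace p.toSubmodule := p.isClosed.completeSpace_coe
  p.toSubmodule.norm_starProjection_apply_le x

theorem norm_proj_eq_iff {p : ClosedSubmodule ℂ E} {x : E} : ‖proj p x‖ = ‖x‖ ↔ x ∈ p :=
  haveI : CompleteSpace p.toSubmodule := p.isClosed.completeSpace_coe
  (p.toSubmodule.mem_iff_norm_starProjection x).symm

theorem proj_apply_eq_zero_iff {p : ClosedSubmodule ℂ E} {x : E} :
    proj p x = 0 ↔ x ∈ p.toSubmoduleᗮ :=
  haveI : CompleteSpace p.toSubmodule := p.isClosed.completeSpace_coe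
  p.toSubmodule.starProjection_apply_eq_zero_iff

theorem inner_proj_self_eq_zero_iff {p : ClosedSubmodule ℂ E} {x : E} :
    ⟪x, proj p x⟫_ℂ = 0 ↔ x ∈ p.toSubmoduleᗮ := by
  rw [inner_proj_self, Complex.ofReal_eq_zero, sq_eq_zero_iff, norm_eq_zero,
    proj_apply_eq_zero_iff]

theorem inner_proj_add_proj_self_eq_zero_iff {p q : ClosedSubmodule ℂ E} {x : E} :
    ⟪x, (proj p + proj q) x⟫_ℂ = 0 ↔ x ∈ p.toSubmoduleᗮ ∧ x ∈ q.toSubmoduleᗮ := by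
  rw [← inner_proj_self_eq_zero_iff, ← inner_proj_self_eq_zero_iff, add_apply, inner_add_right]
  refine add_eq_zero_iff_of_nonneg ?_ ?_ <;>
  · rw [inner_proj_self]
    positivity

theorem supp_proj_add_proj (p q : ClosedSubmodule ℂ E) : supp (proj p + proj q) = p ⊔ q := by
  refine le_antisymm (supp_le_of_forall_mem_orthogonal fun u hu => ?_) (sup_le ?_ ?_)
  · exact inner_proj_add_proj_self_eq_zero_iff.2
      ⟨Submodule.orthogonal_le (le_sup_left (a := p) (b := q)) hu,
        Submodule.orthogonal_le (le_sup_right (a := p) (b := q)) hu⟩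
  · exact fun x hx => mem_supp_iff.2 fun u hu =>
      (Submodule.mem_orthogonal' _ _).1 (inner_proj_add_proj_self_eq_zero_iff.1 hu).1 x hx
  · exact fun x hx => mem_supp_iff.2 fun u hu =>
      (Submodule.mem_orthogonal' _ _).1 (inner_proj_add_proj_self_eq_zero_iff.1 hu).2 x hx

end Supports

/-! ### Positive trace class operators -/

section Ensembles

variable {E : Type*} [NormedAddCommGroup E] [InnerProductSpace ℂ E]
variable {F : Type*} [NormedAddCommGroup F] [InnerProductSpace ℂ F]
variable {I J K : Type*}

theorem hasSum_norm_inner_sq (e : HilbertBasis I ℂ E) (x : E) :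
    HasSum (fun i => ‖⟪x, e i⟫_ℂ‖ ^ 2) (‖x‖ ^ 2) := by
  have h := e.hasSum_inner_mul_inner x x
  simp only [inner_self_eq_norm_sq_to_K, ← inner_conj_symm (e _) x, RCLike.mul_conj,
    Complex.coe_algebraMap] at h
  exact Complex.hasSum_ofReal.1 (by simpa only [Complex.ofReal_pow] using h)

theorem summable_norm_apply_sq {ψ : I → E} (h : Summable fun i => ‖ψ i‖ ^ 2) (A : E →L[ℂ] F) :
    Summable fun i => ‖A (ψ i)‖ ^ 2 :=
  .of_nonneg_of_le (fun _ => by positivity)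
    (fun i => by
      rw [← mul_pow]
      exact pow_le_pow_left₀ (norm_nonneg _) (A.le_opNorm _) 2)
    (h.mul_left (‖A‖ ^ 2))

/-- A decomposition `ρ = ∑ᵢ |ψᵢ⟩⟨ψᵢ|` with `∑ᵢ ‖ψᵢ‖² < ∞` into pure states that need be neither
normalised nor orthogonal. It exhibits `ρ` as a positive trace class operator. -/
structure IsEnsemble (ρ : Op E) (ψ : I → E) : Prop where
  summable : Summable fun i => ‖ψ i‖ ^ 2
  hasSum : HasSum (fun i => rankOne ℂ (ψ i) (ψ i)) ρ

theorem isEnsemble_rankOne (x : E) : IsEnsemble (rankOne ℂ x x) fun _ : Unit => x where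
  summable := (hasSum_fintype _).summable
  hasSum := by simpa only [Finset.univ_unique, Finset.sum_singleton] using
    hasSum_fintype fun _ : Unit => rankOne ℂ x x

namespace IsEnsemble

variable {ρ σ : Op E} {ψ : I → E} {φ : J → E}

theorem of_summable [CompleteSpace E] (h : Summable fun i => ‖ψ i‖ ^ 2) :
    IsEnsemble (∑' i, rankOne ℂ (ψ i) (ψ i)) ψ :=
  ⟨h, (Summable.of_norm (by simpa only [norm_rankOne, ← sq] using h)).hasSum⟩

theorem hasSum_inner (h : IsEnsemble ρ ψ) (x y : E) :
    HasSum (fun i => ⟪x, ψ i⟫_ℂ * ⟪ψ i, y⟫_ℂ) ⟪x, ρ y⟫_ℂ := by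
  have := (h.hasSum.mapL (ContinuousLinearMap.apply ℂ E y)).mapL (innerSL ℂ x)
  simpa [inner_smul_right, mul_comm] using this

theorem inner_self_eq_zero_iff (h : IsEnsemble ρ ψ) {x : E} :
    ⟪x, ρ x⟫_ℂ = 0 ↔ ∀ i, ⟪ψ i, x⟫_ℂ = 0 := by
  have hs := h.hasSum_inner x x
  simp only [← inner_conj_symm x (ψ _), RCLike.conj_mul] at hs
  refine ⟨fun hx i => ?_, fun hx => hs.unique (by simp [hx])⟩
  rw [hx, hasSum_zero_iff_of_nonneg fun _ => by positivity] at hs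
  simpa using congrFun hs i

theorem compl (h : IsEnsemble ρ ψ) (s : Finset I) :
    IsEnsemble (ρ - ∑ i ∈ s, rankOne ℂ (ψ i) (ψ i)) fun i : {i // i ∉ s} => ψ i where
  summable := h.summable.comp_injective Subtype.val_injective
  hasSum := by
    rw [s.hasSum_compl_iff (f := fun i => rankOne ℂ (ψ i) (ψ i)), sub_add_cancel]
    exact h.hasSum

theorem isPositive [CompleteSpace E] (h : IsEnsemble ρ ψ) : ρ.IsPositive :=
  (nonneg_iff_isPositive ρ).1 <| h.hasSum.nonneg fun i =>
    (nonneg_iff_isPositive _).2 (isPositive_rankOne_self (ψ i))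

variable [CompleteSpace E]

theorem sat_iff (h : IsEnsemble ρ ψ) {p : ClosedSubmodule ℂ E} : Sat ρ p ↔ ∀ i, ψ i ∈ p := by
  constructor
  · intro hρ i
    refine hρ (mem_supp_iff.2 fun u hu => ?_)
    rw [← inner_conj_symm, h.inner_self_eq_zero_iff.1 hu i, map_zero]
  · intro hψ
    refine supp_le_of_forall_mem_orthogonal fun u hu => h.inner_self_eq_zero_iff.2 fun i => ?_
    exact (Submodule.mem_orthogonal _ _).1 hu _ (hψ i)

theorem summable_inner_mul_inner (h : IsEnsemble ρ ψ) (A : Op E) :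
    Summable fun x : I × basisIndex E => ⟪onb E x.2, ψ x.1⟫_ℂ * ⟪ψ x.1, A (onb E x.2)⟫_ℂ := by
  have hψ : ∀ {χ : I → E}, (Summable fun i => ‖χ i‖ ^ 2) →
      Summable fun x : I × basisIndex E => ‖⟪χ x.1, onb E x.2⟫_ℂ‖ ^ 2 := fun {χ} hχ => by
    rw [summable_prod_of_nonneg fun _ => by positivity]
    exact ⟨fun i => (hasSum_norm_inner_sq (onb E) (χ i)).summable,
      by simpa only [(hasSum_norm_inner_sq (onb E) _).tsum_eq] using hχ⟩
  refine .of_norm_bounded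
    ((hψ h.summable).add (hψ (summable_norm_apply_sq h.summable (adjoint A)))) fun x => ?_
  rw [norm_mul, ← adjoint_inner_left, norm_inner_symm]
  nlinarith [two_mul_le_add_sq ‖⟪ψ x.1, onb E x.2⟫_ℂ‖ ‖⟪adjoint A (ψ x.1), onb E x.2⟫_ℂ‖,
    norm_nonneg ⟪ψ x.1, onb E x.2⟫_ℂ, norm_nonneg ⟪adjoint A (ψ x.1), onb E x.2⟫_ℂ]

theorem summable_inner_onb (h : IsEnsemble ρ ψ) (A : Op E) :
    Summable fun b => ⟪onb E b, (ρ ∘L A) (onb E b)⟫_ℂ :=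
  ((Equiv.prodComm _ _).summable_iff.2 (h.summable_inner_mul_inner A)).hasSum.prod_fiberwise
    (fun b => h.hasSum_inner (onb E b) (A (onb E b))) |>.summable

theorem hasSum_trace_comp (h : IsEnsemble ρ ψ) (A : Op E) :
    HasSum (fun i => ⟪ψ i, A (ψ i)⟫_ℂ) (trace (ρ ∘L A)) := by
  have hs := (h.summable_inner_mul_inner A).hasSum
  have hrow := hs.prod_fiberwise (g := fun i => ⟪ψ i, A (ψ i)⟫_ℂ) fun i => by
    simpa only [adjoint_inner_left, mul_comm] using
      (onb E).hasSum_inner_mul_inner (adjoint A (ψ i)) (ψ i)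
  have hcol := ((Equiv.prodComm _ _).hasSum_iff.2 hs).prod_fiberwise
    fun b => h.hasSum_inner (onb E b) (A (onb E b))
  rw [trace]
  exact hcol.tsum_eq ▸ hrow

theorem hasSum_trace (h : IsEnsemble ρ ψ) : HasSum (fun i => ((‖ψ i‖ ^ 2 : ℝ) : ℂ)) (trace ρ) := by
  simpa [inner_self_eq_norm_sq_to_K, one_def] using h.hasSum_trace_comp 1

theorem ofReal_trace_re (h : IsEnsemble ρ ψ) : ((trace ρ).re : ℂ) = trace ρ := by
  rw [← h.hasSum_trace.tsum_eq, ← Complex.ofReal_tsum, Complex.ofReal_re]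

theorem hasSum_trace_re (h : IsEnsemble ρ ψ) : HasSum (fun i => ‖ψ i‖ ^ 2) (trace ρ).re :=
  Complex.hasSum_re h.hasSum_trace

theorem sandwich [CompleteSpace F] (h : IsEnsemble ρ ψ) (A : E →L[ℂ] F) :
    IsEnsemble (sandwich A ρ) fun i => A (ψ i) where
  summable := summable_norm_apply_sq h.summable A
  hasSum := by
    have := (h.hasSum.mapL ((compL ℂ F E E).flip (adjoint A))).mapL (compL ℂ F E F A)
    simpa [QTLogic.sandwich, rankOne_comp, comp_rankOne] using this

theorem add (h : IsEnsemble ρ ψ) (h' : IsEnsemble σ φ) :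
    IsEnsemble (ρ + σ) (Sum.elim ψ φ) where
  summable := (HasSum.sum (f := fun x => ‖Sum.elim ψ φ x‖ ^ 2)
    h.summable.hasSum h'.summable.hasSum).summable
  hasSum := HasSum.sum (f := fun x => rankOne ℂ (Sum.elim ψ φ x) (Sum.elim ψ φ x))
    h.hasSum h'.hasSum

end IsEnsemble

/-- Positive trace class operators, the operators that have an ensemble. The index set of the
ensemble is immaterial, see `IsEnsemble.isTraceClass`. -/
def IsTraceClass [CompleteSpace E] (ρ : Op E) : Prop := ∃ ψ : basisIndex E → E, IsEnsemble ρ ψ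

variable [CompleteSpace E]

theorem isTraceClass_of_summable {ρ : Op E} (hpos : ρ.IsPositive)
    (hsum : Summable fun b => ⟪onb E b, ρ (onb E b)⟫_ℂ) : IsTraceClass ρ := by
  have h0 : 0 ≤ ρ := (nonneg_iff_isPositive ρ).2 hpos
  obtain ⟨B, hsa, hBB⟩ : ∃ B : Op E, IsSelfAdjoint B ∧ B * B = ρ :=
    ⟨CFC.sqrt ρ, .of_nonneg (CFC.sqrt_nonneg ρ), CFC.sqrt_mul_sqrt_self ρ h0⟩
  have hB : ∀ x y, ⟪B x, y⟫_ℂ = ⟪x, B y⟫_ℂ := fun x y => by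
    rw [← adjoint_inner_right, ← star_eq_adjoint, hsa.star_eq]
  have hρ : ∀ x y, ⟪x, ρ y⟫_ℂ = ⟪B x, B y⟫_ℂ := fun x y => by
    rw [← hBB, mul_apply_eq_comp, hB]
  simp only [hρ, inner_self_eq_norm_sq_to_K] at hsum
  have hS := IsEnsemble.of_summable (ψ := fun b => B (onb E b))
    (Complex.summable_ofReal.1 (by simpa using hsum))
  refine ⟨fun b => B (onb E b), hS.summable, ?_⟩
  convert hS.hasSum using 1
  ext y
  refine ext_inner_left ℂ fun x => HasSum.unique ?_ (hS.hasSum_inner x y)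
  simpa only [hρ, hB] using (onb E).hasSum_inner_mul_inner (B x) (B y)

theorem isTraceClass_of_mem {ρ : Op E} (h : ρ ∈ PartialDensity E) : IsTraceClass ρ :=
  isTraceClass_of_summable h.1 h.2.1

theorem IsEnsemble.isTraceClass {ρ : Op E} {ψ : I → E} (h : IsEnsemble ρ ψ) : IsTraceClass ρ :=
  isTraceClass_of_summable h.isPositive (by simpa [one_def] using h.summable_inner_onb 1)

theorem isTraceClass_rankOne (x : E) : IsTraceClass (rankOne ℂ x x) :=
  (isEnsemble_rankOne x).isTraceClass

theorem trace_rankOne (x : E) : trace (rankOne ℂ x x) = (‖x‖ ^ 2 : ℝ) :=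
  (isEnsemble_rankOne x).hasSum_trace.unique (by simp)

theorem sat_rankOne_iff {x : E} {p : ClosedSubmodule ℂ E} : Sat (rankOne ℂ x x) p ↔ x ∈ p := by
  simp only [(isEnsemble_rankOne x).sat_iff, forall_const]

namespace IsTraceClass

variable {ρ σ : Op E} {p : ClosedSubmodule ℂ E}

theorem mem_partialDensity (h : IsTraceClass ρ) (h1 : (trace ρ).re ≤ 1) :
    ρ ∈ PartialDensity E :=
  let ⟨_, hψ⟩ := h
  ⟨hψ.isPositive, by simpa [one_def] using hψ.summable_inner_onb 1, h1⟩

theorem trace_nonneg (h : IsTraceClass ρ) : 0 ≤ (trace ρ).re :=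
  let ⟨_, hψ⟩ := h
  hψ.hasSum_trace_re.nonneg fun _ => by positivity

theorem ofReal_trace_re (h : IsTraceClass ρ) : ((trace ρ).re : ℂ) = trace ρ :=
  let ⟨_, hψ⟩ := h
  hψ.ofReal_trace_re

theorem trace_eq_iff (hρ : IsTraceClass ρ) {σ : Op F} [CompleteSpace F] (hσ : IsTraceClass σ) :
    trace σ = trace ρ ↔ (trace σ).re = (trace ρ).re := by
  rw [← hρ.ofReal_trace_re, ← hσ.ofReal_trace_re, Complex.ofReal_inj, Complex.ofReal_re,
    Complex.ofReal_re]

theorem zero : IsTraceClass (0 : Op E) :=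
  isTraceClass_of_summable isPositive_zero (by simp)

theorem add (hρ : IsTraceClass ρ) (hσ : IsTraceClass σ) : IsTraceClass (ρ + σ) :=
  let ⟨_, hψ⟩ := hρ
  let ⟨_, hφ⟩ := hσ
  (hψ.add hφ).isTraceClass

theorem trace_comp_add (hρ : IsTraceClass ρ) (hσ : IsTraceClass σ) (A : Op E) :
    trace ((ρ + σ) ∘L A) = trace (ρ ∘L A) + trace (σ ∘L A) := by
  obtain ⟨_, hψ⟩ := hρ
  obtain ⟨_, hφ⟩ := hσ
  simpa [trace] using (hψ.summable_inner_onb A).tsum_add (hφ.summable_inner_onb A)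

theorem trace_add (hρ : IsTraceClass ρ) (hσ : IsTraceClass σ) :
    trace (ρ + σ) = trace ρ + trace σ := by
  simpa only [one_def, comp_id] using hρ.trace_comp_add hσ 1

theorem sat_add_iff (hρ : IsTraceClass ρ) (hσ : IsTraceClass σ) :
    Sat (ρ + σ) p ↔ Sat ρ p ∧ Sat σ p := by
  obtain ⟨_, hψ⟩ := hρ
  obtain ⟨_, hφ⟩ := hσ
  simp only [(hψ.add hφ).sat_iff, hψ.sat_iff, hφ.sat_iff, Sum.forall, Sum.elim_inl, Sum.elim_inr]

theorem sum {s : Finset K} {ρ : K → Op E} (h : ∀ k, IsTraceClass (ρ k)) :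
    IsTraceClass (∑ k ∈ s, ρ k) :=
  Finset.sum_induction _ _ (fun _ _ => add) zero fun k _ => h k

theorem exists_isEnsemble_tsum {ρ : K → Op E} (h : ∀ k, IsTraceClass (ρ k))
    (hs : Summable fun k => (trace (ρ k)).re) :
    ∃ ψ : K × basisIndex E → E, (∀ k, IsEnsemble (ρ k) fun b => ψ (k, b)) ∧
      HasSum ρ (∑' k, ρ k) ∧ IsEnsemble (∑' k, ρ k) ψ := by
  choose ψ hψ using h
  have hsum : Summable fun x : K × basisIndex E => ‖ψ x.1 x.2‖ ^ 2 := by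
    rw [summable_prod_of_nonneg fun _ => by positivity]
    exact ⟨fun k => (hψ k).summable, by simpa only [(hψ _).hasSum_trace_re.tsum_eq] using hs⟩
  have hens := IsEnsemble.of_summable hsum
  have hρ := hens.hasSum.prod_fiberwise fun k => (hψ k).hasSum
  rw [← hρ.tsum_eq] at hens hρ
  exact ⟨fun x => ψ x.1 x.2, hψ, hρ, hens⟩

theorem tsum {ρ : K → Op E} (h : ∀ k, IsTraceClass (ρ k))
    (hs : Summable fun k => (trace (ρ k)).re) : IsTraceClass (∑' k, ρ k) :=
  let ⟨_, _, _, hens⟩ := exists_isEnsemble_tsum h hs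
  hens.isTraceClass

theorem summable {ρ : K → Op E} (h : ∀ k, IsTraceClass (ρ k))
    (hs : Summable fun k => (trace (ρ k)).re) : Summable ρ :=
  let ⟨_, _, hρ, _⟩ := exists_isEnsemble_tsum h hs
  hρ.summable

theorem hasSum_trace_comp_tsum {ρ : K → Op E} (h : ∀ k, IsTraceClass (ρ k))
    (hs : Summable fun k => (trace (ρ k)).re) (A : Op E) :
    HasSum (fun k => trace (ρ k ∘L A)) (trace ((∑' k, ρ k) ∘L A)) :=
  let ⟨_, hψ, _, hens⟩ := exists_isEnsemble_tsum h hs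
  (hens.hasSum_trace_comp A).prod_fiberwise fun k => (hψ k).hasSum_trace_comp A

theorem hasSum_trace_tsum {ρ : K → Op E} (h : ∀ k, IsTraceClass (ρ k))
    (hs : Summable fun k => (trace (ρ k)).re) :
    HasSum (fun k => trace (ρ k)) (trace (∑' k, ρ k)) := by
  simpa only [one_def, comp_id] using hasSum_trace_comp_tsum h hs 1

theorem sat_tsum_iff {ρ : K → Op E} (h : ∀ k, IsTraceClass (ρ k))
    (hs : Summable fun k => (trace (ρ k)).re) : Sat (∑' k, ρ k) p ↔ ∀ k, Sat (ρ k) p := by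
  obtain ⟨ψ, hψ, -, hens⟩ := exists_isEnsemble_tsum h hs
  simp only [hens.sat_iff, (hψ _).sat_iff, Prod.forall]

theorem trace_comp_sum {s : Finset K} {ρ : K → Op E} (h : ∀ k, IsTraceClass (ρ k)) (A : Op E) :
    trace ((∑ k ∈ s, ρ k) ∘L A) = ∑ k ∈ s, trace (ρ k ∘L A) := by
  rw [← s.tsum_subtype, ← s.tsum_subtype fun k => trace (ρ k ∘L A)]
  exact (hasSum_trace_comp_tsum (ρ := fun k : s => ρ k) (fun k => h k)
    (hasSum_fintype _).summable A).tsum_eq.symm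

theorem trace_sum {s : Finset K} {ρ : K → Op E} (h : ∀ k, IsTraceClass (ρ k)) :
    trace (∑ k ∈ s, ρ k) = ∑ k ∈ s, trace (ρ k) := by
  simpa only [one_def, comp_id] using trace_comp_sum h 1

theorem sat_sum_iff {s : Finset K} {ρ : K → Op E} (h : ∀ k, IsTraceClass (ρ k)) :
    Sat (∑ k ∈ s, ρ k) p ↔ ∀ k ∈ s, Sat (ρ k) p := by
  rw [← s.tsum_subtype,
    sat_tsum_iff (ρ := fun k : s => ρ k) (fun k => h k) (hasSum_fintype _).summable, Subtype.forall]

variable [CompleteSpace F]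

theorem sandwich (h : IsTraceClass ρ) (A : E →L[ℂ] F) : IsTraceClass (sandwich A ρ) :=
  let ⟨_, hψ⟩ := h
  (hψ.sandwich A).isTraceClass

theorem sat_sandwich_iff (h : IsTraceClass ρ) {A : E →L[ℂ] F} {p : ClosedSubmodule ℂ F} :
    Sat (QTLogic.sandwich A ρ) p ↔ Sat ρ (p.comap A) := by
  obtain ⟨_, hψ⟩ := h
  rw [(hψ.sandwich A).sat_iff, hψ.sat_iff]
  rfl

theorem trace_sandwich_le (h : IsTraceClass ρ) {A : E →L[ℂ] F} (hA : ∀ x, ‖A x‖ ≤ ‖x‖) :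
    (trace (QTLogic.sandwich A ρ)).re ≤ (trace ρ).re := by
  obtain ⟨_, hψ⟩ := h
  exact hasSum_le (fun i => pow_le_pow_left₀ (norm_nonneg _) (hA _) 2)
    (hψ.sandwich A).hasSum_trace_re hψ.hasSum_trace_re

theorem hasSum_trace_sandwich (h : IsTraceClass ρ) {A : K → E →L[ℂ] F}
    (hA : ∀ x, HasSum (fun k => ‖A k x‖ ^ 2) (‖x‖ ^ 2)) :
    HasSum (fun k => (trace (QTLogic.sandwich (A k) ρ)).re) (trace ρ).re := by
  obtain ⟨ψ, hψ⟩ := h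
  have hs : Summable fun x : basisIndex E × K => ‖A x.2 (ψ x.1)‖ ^ 2 := by
    rw [summable_prod_of_nonneg fun _ => by positivity]
    exact ⟨fun i => (hA (ψ i)).summable, by simpa only [(hA _).tsum_eq] using hψ.summable⟩
  have hrow := hs.hasSum.prod_fiberwise fun i => hA (ψ i)
  rw [hψ.hasSum_trace_re.unique hrow]
  exact ((Equiv.prodComm _ _).hasSum_iff.2 hs.hasSum).prod_fiberwise
    fun k => (hψ.sandwich (A k)).hasSum_trace_re

theorem sum_trace_sandwich [Fintype K] (h : IsTraceClass ρ) {A : K → E →L[ℂ] F}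
    (hA : ∀ x, ∑ k, ‖A k x‖ ^ 2 = ‖x‖ ^ 2) :
    ∑ k, trace (QTLogic.sandwich (A k) ρ) = trace ρ := by
  have hsum := h.hasSum_trace_sandwich fun x => hA x ▸ hasSum_fintype fun k => ‖A k x‖ ^ 2
  rw [← h.ofReal_trace_re, hsum.unique (hasSum_fintype _), Complex.ofReal_sum]
  exact Finset.sum_congr rfl fun k _ => ((h.sandwich (A k)).ofReal_trace_re).symm

theorem trace_comp_proj (h : IsTraceClass ρ) (p : ClosedSubmodule ℂ E) :
    trace (ρ ∘L proj p) = trace (QTLogic.sandwich (proj p) ρ) := by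
  obtain ⟨ψ, hψ⟩ := h
  have hs := hψ.hasSum_trace_comp (proj p)
  simp only [inner_proj_self] at hs
  exact hs.unique (hψ.sandwich (proj p)).hasSum_trace

theorem trace_comp_proj_nonneg (h : IsTraceClass ρ) (p : ClosedSubmodule ℂ E) :
    0 ≤ (trace (ρ ∘L proj p)).re := by
  rw [h.trace_comp_proj]
  exact (h.sandwich _).trace_nonneg

theorem trace_comp_proj_le (h : IsTraceClass ρ) (p : ClosedSubmodule ℂ E) :
    (trace (ρ ∘L proj p)).re ≤ (trace ρ).re := by
  rw [h.trace_comp_proj]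
  exact h.trace_sandwich_le (norm_proj_le p)

theorem trace_comp_proj_eq_iff (h : IsTraceClass ρ) :
    (trace (ρ ∘L proj p)).re = (trace ρ).re ↔ Sat ρ p := by
  rw [h.trace_comp_proj]
  obtain ⟨ψ, hψ⟩ := h
  have hproj := (hψ.sandwich (proj p)).hasSum_trace_re
  have hle : ∀ i, ‖proj p (ψ i)‖ ^ 2 ≤ ‖ψ i‖ ^ 2 := fun i =>
    pow_le_pow_left₀ (norm_nonneg _) (norm_proj_le p _) 2
  rw [hψ.sat_iff]
  constructor
  · intro heq i
    by_contra hi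
    have hlt := (norm_proj_le p (ψ i)).lt_of_ne (mt norm_proj_eq_iff.1 hi)
    exact (hasSum_lt hle (pow_lt_pow_left₀ hlt (norm_nonneg _) two_ne_zero) hproj
      hψ.hasSum_trace_re).ne heq
  · intro hp
    exact hproj.unique (by simpa only [norm_proj_eq_iff.2 (hp _)] using hψ.hasSum_trace_re)

end IsTraceClass

theorem sandwich_sandwich {G : Type*} [NormedAddCommGroup G] [InnerProductSpace ℂ G]
    [CompleteSpace F] [CompleteSpace G] (A : F →L[ℂ] G) (B : E →L[ℂ] F) (ρ : Op E) :
    sandwich A (sandwich B ρ) = sandwich (A ∘L B) ρ := by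
  simp only [sandwich, adjoint_comp, comp_assoc]

theorem sandwich_add [CompleteSpace F] (A : E →L[ℂ] F) (ρ σ : Op E) :
    sandwich A (ρ + σ) = sandwich A ρ + sandwich A σ := by
  simp only [sandwich, add_comp, comp_add]

theorem sandwich_sum [CompleteSpace F] [Fintype K] (A : E →L[ℂ] F) (ρ : K → Op E) :
    sandwich A (∑ k, ρ k) = ∑ k, sandwich A (ρ k) := by
  simp only [sandwich, finsetSum_comp, comp_finsetSum]

theorem sandwich_one (ρ : Op E) : sandwich 1 ρ = ρ := by
  rw [sandwich, adjoint_one]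
  rfl

theorem sandwich_zero_left [CompleteSpace F] (ρ : Op E) : sandwich (0 : E →L[ℂ] F) ρ = 0 := by
  simp [sandwich]

theorem forall_sat_iff_le {P R : ClosedSubmodule ℂ E} :
    (∀ ρ ∈ PartialDensity E, Sat ρ P → Sat ρ R) ↔ P ≤ R := by
  refine ⟨fun h => le_of_forall_norm_eq_one fun x hx hx1 => ?_, fun h ρ _ hρ => hρ.trans h⟩
  refine sat_rankOne_iff.1 (h _ ((isTraceClass_rankOne x).mem_partialDensity ?_)
    (sat_rankOne_iff.2 hx))
  simp [trace_rankOne, hx1]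

end Ensembles

/-! ### Weights and operations -/

section Operations

variable {E : Type*} [NormedAddCommGroup E] [InnerProductSpace ℂ E] [CompleteSpace E]
variable {F : Type*} [NormedAddCommGroup F] [InnerProductSpace ℂ F] [CompleteSpace F]
variable {G : Type*} [NormedAddCommGroup G] [InnerProductSpace ℂ G] [CompleteSpace G]

/-- A positive additive functional on the positive trace class operators that is dominated by the
trace. Such a functional is automatically normal, see `IsWeight.hasSum`. -/
structure IsWeight (w : Op E → ℝ) : Prop where
  nonneg {ρ : Op E} : IsTraceClass ρ → 0 ≤ w ρ
  le_trace {ρ : Op E} : IsTraceClass ρ → w ρ ≤ (trace ρ).re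
  map_add {ρ σ : Op E} : IsTraceClass ρ → IsTraceClass σ → w (ρ + σ) = w ρ + w σ

namespace IsWeight

variable {w : Op E → ℝ}

theorem map_zero (h : IsWeight w) : w 0 = 0 := by
  simpa using h.map_add .zero .zero

theorem map_sum (h : IsWeight w) {K : Type*} {ρ : K → Op E} (hρ : ∀ k, IsTraceClass (ρ k))
    (s : Finset K) : w (∑ k ∈ s, ρ k) = ∑ k ∈ s, w (ρ k) := by
  classical
  induction s using Finset.induction_on with
  | empty => simp only [Finset.sum_empty, h.map_zero]
  | insert a s ha ih =>
    rw [Finset.sum_insert ha, Finset.sum_insert ha, h.map_add (hρ a) (.sum hρ), ih]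

theorem hasSum (h : IsWeight w) {I : Type*} {ρ : Op E} {ψ : I → E} (hψ : IsEnsemble ρ ψ) :
    HasSum (fun i => w (rankOne ℂ (ψ i) (ψ i))) (w ρ) := by
  have htail : ∀ s : Finset I, w ρ =
      w (ρ - ∑ i ∈ s, rankOne ℂ (ψ i) (ψ i)) + ∑ i ∈ s, w (rankOne ℂ (ψ i) (ψ i)) := fun s => by
    rw [← h.map_sum (fun i => isTraceClass_rankOne (ψ i)), ← h.map_add
      (hψ.compl s).isTraceClass (.sum fun i => isTraceClass_rankOne (ψ i)), sub_add_cancel]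
  have htrace : ∀ s : Finset I, (trace (ρ - ∑ i ∈ s, rankOne ℂ (ψ i) (ψ i))).re =
      (trace ρ).re - ∑ i ∈ s, ‖ψ i‖ ^ 2 := fun s => eq_sub_of_add_eq <|
    (s.hasSum_compl_iff.1 (hψ.compl s).hasSum_trace_re).unique hψ.hasSum_trace_re
  have hlim : Tendsto (fun s : Finset I => w (ρ - ∑ i ∈ s, rankOne ℂ (ψ i) (ψ i)))
      atTop (𝓝 0) := by
    refine squeeze_zero (fun s => h.nonneg (hψ.compl s).isTraceClass)
      (fun s => (h.le_trace (hψ.compl s).isTraceClass).trans_eq (htrace s)) ?_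
    have hsub : Tendsto (fun s : Finset I => (trace ρ).re - ∑ i ∈ s, ‖ψ i‖ ^ 2) atTop
        (𝓝 ((trace ρ).re - (trace ρ).re)) := tendsto_const_nhds.sub hψ.hasSum_trace_re
    rwa [sub_self] at hsub
  have hsum := (tendsto_const_nhds (x := w ρ)).sub hlim
  rw [sub_zero] at hsum
  exact hsum.congr fun s => sub_eq_of_eq_add' (htail s)

theorem eq_zero_iff (h : IsWeight w) {I : Type*} {ρ : Op E} {ψ : I → E} (hψ : IsEnsemble ρ ψ) :
    w ρ = 0 ↔ ∀ i, w (rankOne ℂ (ψ i) (ψ i)) = 0 := by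
  have hsum := h.hasSum hψ
  refine ⟨fun hρ i => ?_, fun h0 => hsum.unique (by simp only [h0, hasSum_zero])⟩
  rw [hρ, hasSum_zero_iff_of_nonneg fun i => h.nonneg (isTraceClass_rankOne _)] at hsum
  exact congrFun hsum i

theorem rankOne_le (h : IsWeight w) (x : E) : w (rankOne ℂ x x) ≤ ‖x‖ ^ 2 :=
  (h.le_trace (isTraceClass_rankOne x)).trans_eq (by rw [trace_rankOne, Complex.ofReal_re])

theorem rankOne_add_le (h : IsWeight w) (x y : E) :
    w (rankOne ℂ (x + y) (x + y)) ≤ 2 * (w (rankOne ℂ x x) + w (rankOne ℂ y y)) := by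
  have hparallelogram : rankOne ℂ (x + y) (x + y) + rankOne ℂ (x - y) (x - y) =
      (rankOne ℂ x x + rankOne ℂ y y) + (rankOne ℂ x x + rankOne ℂ y y) := by
    simp only [_root_.map_add, map_sub, add_apply, sub_apply]
    abel
  have hxy := (isTraceClass_rankOne x).add (isTraceClass_rankOne y)
  have heq := congrArg w hparallelogram
  rw [h.map_add (isTraceClass_rankOne _) (isTraceClass_rankOne _), h.map_add hxy hxy,
    h.map_add (isTraceClass_rankOne _) (isTraceClass_rankOne _)] at heq
  linarith [h.nonneg (isTraceClass_rankOne (x - y))]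

theorem rankOne_smul_eq_zero (h : IsWeight w) {x : E} (hx : w (rankOne ℂ x x) = 0) (c : ℂ) :
    w (rankOne ℂ (c • x) (c • x)) = 0 := by
  obtain ⟨n, hn⟩ := exists_nat_ge (‖c‖ ^ 2)
  obtain ⟨d, hd⟩ : ∃ d : ℂ, ‖d‖ ^ 2 = n - ‖c‖ ^ 2 := ⟨(√(n - ‖c‖ ^ 2) : ℝ), by
    rw [Complex.norm_real, Real.norm_eq_abs, sq_abs, Real.sq_sqrt (sub_nonneg.2 hn)]⟩
  have hsmul : ∀ a : ℂ, rankOne ℂ (a • x) (a • x) = ((‖a‖ ^ 2 : ℝ) : ℂ) • rankOne ℂ x x :=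
    fun a => by simp [smul_smul, RCLike.mul_conj]
  have hsplit : rankOne ℂ (c • x) (c • x) + rankOne ℂ (d • x) (d • x) =
      ∑ _ : Fin n, rankOne ℂ x x := by
    rw [hsmul, hsmul, ← add_smul, hd, ← Complex.ofReal_add, add_sub_cancel]
    simp [Nat.cast_smul_eq_nsmul]
  have heq := congrArg w hsplit
  rw [h.map_add (isTraceClass_rankOne _) (isTraceClass_rankOne _),
    h.map_sum fun _ => isTraceClass_rankOne x, hx, Finset.sum_const_zero] at heq
  linarith [h.nonneg (isTraceClass_rankOne (c • x)), h.nonneg (isTraceClass_rankOne (d • x))]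

theorem isClosed_null (h : IsWeight w) : IsClosed {x | w (rankOne ℂ x x) = 0} := by
  refine isClosed_of_closure_subset fun x hx => ?_
  refine le_antisymm (le_of_forall_pos_le_add fun ε hε => ?_) (h.nonneg (isTraceClass_rankOne x))
  obtain ⟨y, hy : w (rankOne ℂ y y) = 0, hxy⟩ :=
    Metric.mem_closure_iff.1 hx √(ε / 2) (by positivity)
  rw [dist_eq_norm, Real.lt_sqrt (norm_nonneg _)] at hxy
  have hadd := h.rankOne_add_le y (x - y)
  rw [add_sub_cancel, hy] at hadd
  linarith [h.rankOne_le (x - y)]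

/-- The null space of a weight: the vectors `x` for which it vanishes on `|x⟩⟨x|`. -/
def nullSpace (h : IsWeight w) : ClosedSubmodule ℂ E where
  carrier := {x | w (rankOne ℂ x x) = 0}
  add_mem' {x y} hx hy := le_antisymm
    ((h.rankOne_add_le x y).trans_eq (by rw [hx, hy, add_zero, mul_zero]))
    (h.nonneg (isTraceClass_rankOne _))
  zero_mem' := by simpa using h.map_zero
  smul_mem' c _ hx := h.rankOne_smul_eq_zero hx c
  isClosed' := h.isClosed_null

theorem eq_zero_iff_sat (h : IsWeight w) {ρ : Op E} (hρ : IsTraceClass ρ) :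
    w ρ = 0 ↔ Sat ρ h.nullSpace := by
  obtain ⟨ψ, hψ⟩ := hρ
  rw [h.eq_zero_iff hψ, hψ.sat_iff]
  rfl

end IsWeight

/-- A (Davies–Lewis) operation: a positive, additive and trace-nonincreasing transformation of
positive trace class operators. -/
structure IsOperation (𝓔 : Op E → Op F) : Prop where
  isTraceClass {ρ : Op E} : IsTraceClass ρ → IsTraceClass (𝓔 ρ)
  map_add {ρ σ : Op E} : IsTraceClass ρ → IsTraceClass σ → 𝓔 (ρ + σ) = 𝓔 ρ + 𝓔 σ
  trace_le {ρ : Op E} : IsTraceClass ρ → (trace (𝓔 ρ)).re ≤ (trace ρ).re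

theorem isOperation_id : IsOperation (id : Op E → Op E) where
  isTraceClass := id
  map_add _ _ := rfl
  trace_le _ := le_rfl

theorem isOperation_sandwich {A : E →L[ℂ] F} (hA : ∀ x, ‖A x‖ ≤ ‖x‖) :
    IsOperation (sandwich A) where
  isTraceClass hρ := hρ.sandwich A
  map_add _ _ := sandwich_add A _ _
  trace_le hρ := hρ.trace_sandwich_le hA

namespace IsOperation

variable {𝓔 : Op E → Op F}

theorem map_zero (h : IsOperation 𝓔) : 𝓔 0 = 0 := by
  simpa using h.map_add .zero .zero

theorem mem_partialDensity (h : IsOperation 𝓔) {ρ : Op E} (hρ : ρ ∈ PartialDensity E) :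
    𝓔 ρ ∈ PartialDensity F :=
  (h.isTraceClass (isTraceClass_of_mem hρ)).mem_partialDensity
    ((h.trace_le (isTraceClass_of_mem hρ)).trans hρ.2.2)

theorem comp {𝓕 : Op F → Op G} (h' : IsOperation 𝓕) (h : IsOperation 𝓔) :
    IsOperation (𝓕 ∘ 𝓔) where
  isTraceClass hρ := h'.isTraceClass (h.isTraceClass hρ)
  map_add hρ hσ := by
    simp only [Function.comp_apply, h.map_add hρ hσ,
      h'.map_add (h.isTraceClass hρ) (h.isTraceClass hσ)]
  trace_le hρ := (h'.trace_le (h.isTraceClass hρ)).trans (h.trace_le hρ)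

theorem iterate {𝓔 : Op E → Op E} (h : IsOperation 𝓔) : ∀ n, IsOperation 𝓔^[n]
  | 0 => isOperation_id
  | n + 1 => (h.iterate n).comp h

theorem tsum {K : Type*} {𝓔 : K → Op E → Op F} (h : ∀ k, IsOperation (𝓔 k))
    (hs : ∀ {ρ}, IsTraceClass ρ → Summable fun k => (trace (𝓔 k ρ)).re)
    (hle : ∀ {ρ}, IsTraceClass ρ → ∑' k, (trace (𝓔 k ρ)).re ≤ (trace ρ).re) :
    IsOperation fun ρ => ∑' k, 𝓔 k ρ where
  isTraceClass hρ := .tsum (fun k => (h k).isTraceClass hρ) (hs hρ)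
  map_add hρ hσ := by
    simp only [(h _).map_add hρ hσ]
    exact (IsTraceClass.summable (fun k => (h k).isTraceClass hρ) (hs hρ)).tsum_add
      (IsTraceClass.summable (fun k => (h k).isTraceClass hσ) (hs hσ))
  trace_le hρ := by
    have hsum := IsTraceClass.hasSum_trace_tsum (fun k => (h k).isTraceClass hρ) (hs hρ)
    exact (Complex.hasSum_re hsum).tsum_eq ▸ hle hρ

theorem isWeight_trace_sub_trace (h : IsOperation 𝓔) :
    IsWeight fun ρ => (trace ρ).re - (trace (𝓔 ρ)).re where
  nonneg hρ := sub_nonneg.2 (h.trace_le hρ)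
  le_trace hρ := sub_le_self _ (h.isTraceClass hρ).trace_nonneg
  map_add hρ hσ := by
    rw [h.map_add hρ hσ, hρ.trace_add hσ, (h.isTraceClass hρ).trace_add (h.isTraceClass hσ),
      Complex.add_re, Complex.add_re]
    ring

theorem isWeight_trace_sub_trace_comp_proj (h : IsOperation 𝓔) (q : ClosedSubmodule ℂ F) :
    IsWeight fun ρ => (trace (𝓔 ρ)).re - (trace (𝓔 ρ ∘L proj q)).re where
  nonneg hρ := sub_nonneg.2 ((h.isTraceClass hρ).trace_comp_proj_le q)
  le_trace hρ := (sub_le_self _ ((h.isTraceClass hρ).trace_comp_proj_nonneg q)).trans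
    (h.trace_le hρ)
  map_add hρ hσ := by
    rw [h.map_add hρ hσ, (h.isTraceClass hρ).trace_add (h.isTraceClass hσ),
      (h.isTraceClass hρ).trace_comp_add (h.isTraceClass hσ), Complex.add_re, Complex.add_re]
    ring

/-- The weakest liberal precondition for `𝓔` to establish `q`. -/
def wlp (h : IsOperation 𝓔) (q : ClosedSubmodule ℂ F) : ClosedSubmodule ℂ E :=
  (h.isWeight_trace_sub_trace_comp_proj q).nullSpace

/-- The weakest precondition for `𝓔` to preserve the trace. -/
def losslessSpace (h : IsOperation 𝓔) : ClosedSubmodule ℂ E := h.isWeight_trace_sub_trace.nullSpace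

theorem sat_wlp_iff (h : IsOperation 𝓔) {ρ : Op E} (hρ : IsTraceClass ρ)
    {q : ClosedSubmodule ℂ F} : Sat ρ (h.wlp q) ↔ Sat (𝓔 ρ) q := by
  rw [wlp, ← IsWeight.eq_zero_iff_sat _ hρ, sub_eq_zero, eq_comm,
    (h.isTraceClass hρ).trace_comp_proj_eq_iff]

theorem sat_losslessSpace_iff (h : IsOperation 𝓔) {ρ : Op E} (hρ : IsTraceClass ρ) :
    Sat ρ h.losslessSpace ↔ trace (𝓔 ρ) = trace ρ := by
  rw [losslessSpace, ← IsWeight.eq_zero_iff_sat _ hρ, sub_eq_zero,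
    hρ.trace_eq_iff (h.isTraceClass hρ), eq_comm]

end IsOperation

end Operations

/-! ### While loops -/

section Loops

variable {E : Type*} [NormedAddCommGroup E] [InnerProductSpace ℂ E] [CompleteSpace E]
variable {M₀ M₁ : Op E} {𝓔 : Op E → Op E} {ρ : Op E} {P q r : ClosedSubmodule ℂ E}

theorem denote_apply (𝓔 : Op E → Op E) (ρ : Op E) : denote (.apply 𝓔) ρ = 𝓔 ρ := by
  have hreached : ∀ n, reached (some (.apply 𝓔), ρ) (n + 2) = 0 := fun n => by
    induction n with
    | zero => simp [reached, successors, transitions]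
    | succ n ih => rw [reached, ih, Multiset.zero_bind]
  rw [denote, tsum_eq_single 1]
  · simp [outputs, reached, successors, transitions, Multiset.filter_singleton]
  · rintro (_ | _ | n) hn
    · simp [outputs, reached, Multiset.filter_singleton]
    · exact absurd rfl hn
    · simp [outputs, hreached]

/-- One round of the loop `while M = 1 do 𝓔 od` on the part of the state that stays inside. -/
def loopStep (M₁ : Op E) (𝓔 : Op E → Op E) (ρ : Op E) : Op E := 𝓔 (sandwich M₁ ρ)

theorem reached_loop_even (M₀ M₁ : Op E) (𝓔 : Op E → Op E) (ρ : Op E) (n : ℕ) :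
    reached (some (.loop M₀ M₁ (.apply 𝓔)), ρ) (2 * n) =
      {(some (.loop M₀ M₁ (.apply 𝓔)), (loopStep M₁ 𝓔)^[n] ρ)} := by
  induction n with
  | zero => simp [reached]
  | succ n ih =>
    rw [mul_add_one, reached, reached, ih, Function.iterate_succ_apply']
    simp [successors, transitions, loopStep, seqOpt]

theorem outputs_loop_even (M₀ M₁ : Op E) (𝓔 : Op E → Op E) (ρ : Op E) (n : ℕ) :
    outputs (.loop M₀ M₁ (.apply 𝓔)) ρ (2 * n) = 0 := by
  simp [outputs, reached_loop_even, Multiset.filter_singleton]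

theorem outputs_loop_odd (M₀ M₁ : Op E) (𝓔 : Op E → Op E) (ρ : Op E) (n : ℕ) :
    outputs (.loop M₀ M₁ (.apply 𝓔)) ρ (2 * n + 1) =
      {sandwich M₀ ((loopStep M₁ 𝓔)^[n] ρ)} := by
  rw [outputs, reached, reached_loop_even]
  simp [successors, transitions, Multiset.insert_eq_cons, Multiset.filter_singleton]

theorem denote_loop (M₀ M₁ : Op E) (𝓔 : Op E → Op E) (ρ : Op E) :
    denote (.loop M₀ M₁ (.apply 𝓔)) ρ = ∑' n, sandwich M₀ ((loopStep M₁ 𝓔)^[n] ρ) := by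
  have hinj : Function.Injective fun n : ℕ => 2 * n + 1 := fun a b h => by simpa using h
  rw [denote, ← hinj.tsum_eq]
  · simp only [outputs_loop_odd, Multiset.sum_singleton]
  · intro m hm
    obtain ⟨k, rfl | rfl⟩ := m.even_or_odd'
    · simp [outputs_loop_even] at hm
    · exact ⟨k, rfl⟩

/-- The data of a loop `while M = 1 do 𝓔 od`: a measurement with operators `M₀`, `M₁` and a trace
preserving operation `𝓔`. -/
structure IsQuantumLoop (M₀ M₁ : Op E) (𝓔 : Op E → Op E) : Prop where
  norm_sq_add_norm_sq (x : E) : ‖M₀ x‖ ^ 2 + ‖M₁ x‖ ^ 2 = ‖x‖ ^ 2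
  isOperation : IsOperation 𝓔
  trace_apply {ρ : Op E} : IsTraceClass ρ → trace (𝓔 ρ) = trace ρ

theorem validPar_iff_le_wlp {S : QWhile E} (h : IsOperation (denote S)) :
    ValidPar S P q ↔ P ≤ h.wlp q := by
  rw [← forall_sat_iff_le]
  exact forall₂_congr fun ρ hρ => by rw [h.sat_wlp_iff (isTraceClass_of_mem hρ)]

theorem validTot_iff_le_wlp_inf {S : QWhile E} (h : IsOperation (denote S)) :
    ValidTot S P q ↔ P ≤ h.wlp q ⊓ h.losslessSpace := by
  rw [← forall_sat_iff_le]
  refine forall₂_congr fun ρ hρ => imp_congr_right fun _ => ?_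
  rw [← h.sat_wlp_iff (isTraceClass_of_mem hρ), ← h.sat_losslessSpace_iff (isTraceClass_of_mem hρ)]
  exact le_inf_iff.symm

namespace IsQuantumLoop

theorem norm_exit_le (h : IsQuantumLoop M₀ M₁ 𝓔) (x : E) : ‖M₀ x‖ ≤ ‖x‖ :=
  le_of_sq_le_sq (by linarith [h.norm_sq_add_norm_sq x, sq_nonneg ‖M₁ x‖]) (norm_nonneg x)

theorem norm_guard_le (h : IsQuantumLoop M₀ M₁ 𝓔) (x : E) : ‖M₁ x‖ ≤ ‖x‖ :=
  le_of_sq_le_sq (by linarith [h.norm_sq_add_norm_sq x, sq_nonneg ‖M₀ x‖]) (norm_nonneg x)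

theorem isOperation_loopStep (h : IsQuantumLoop M₀ M₁ 𝓔) : IsOperation (loopStep M₁ 𝓔) :=
  h.isOperation.comp (isOperation_sandwich h.norm_guard_le)

theorem isTraceClass_iterate (h : IsQuantumLoop M₀ M₁ 𝓔) (hρ : IsTraceClass ρ) (n : ℕ) :
    IsTraceClass ((loopStep M₁ 𝓔)^[n] ρ) :=
  (h.isOperation_loopStep.iterate n).isTraceClass hρ

theorem isTraceClass_exit (h : IsQuantumLoop M₀ M₁ 𝓔) (hρ : IsTraceClass ρ) (n : ℕ) :
    IsTraceClass (sandwich M₀ ((loopStep M₁ 𝓔)^[n] ρ)) :=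
  (h.isTraceClass_iterate hρ n).sandwich M₀

theorem trace_exit_add_trace_loopStep (h : IsQuantumLoop M₀ M₁ 𝓔) (hρ : IsTraceClass ρ) :
    (trace (sandwich M₀ ρ)).re + (trace (loopStep M₁ 𝓔 ρ)).re = (trace ρ).re := by
  have hsum := hρ.hasSum_trace_sandwich (A := ![M₀, M₁]) fun x => by
    rw [← h.norm_sq_add_norm_sq x]
    simpa using hasSum_fintype fun k => ‖![M₀, M₁] k x‖ ^ 2
  rw [loopStep, h.trace_apply (hρ.sandwich M₁)]
  simpa using (hasSum_fintype _).unique hsum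

theorem sum_trace_exit (h : IsQuantumLoop M₀ M₁ 𝓔) (hρ : IsTraceClass ρ) (n : ℕ) :
    ∑ m ∈ Finset.range n, (trace (sandwich M₀ ((loopStep M₁ 𝓔)^[m] ρ))).re =
      (trace ρ).re - (trace ((loopStep M₁ 𝓔)^[n] ρ)).re := by
  induction n with
  | zero => simp
  | succ n ih =>
    rw [Finset.sum_range_succ, ih, Function.iterate_succ_apply',
      ← h.trace_exit_add_trace_loopStep (h.isTraceClass_iterate hρ n)]
    ring

theorem antitone_trace_iterate (h : IsQuantumLoop M₀ M₁ 𝓔) (hρ : IsTraceClass ρ) :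
    Antitone fun n => (trace ((loopStep M₁ 𝓔)^[n] ρ)).re :=
  antitone_nat_of_succ_le fun n => by
    rw [Function.iterate_succ_apply']
    exact h.isOperation_loopStep.trace_le (h.isTraceClass_iterate hρ n)

theorem sum_trace_exit_le (h : IsQuantumLoop M₀ M₁ 𝓔) (hρ : IsTraceClass ρ) (n : ℕ) :
    ∑ m ∈ Finset.range n, (trace (sandwich M₀ ((loopStep M₁ 𝓔)^[m] ρ))).re ≤ (trace ρ).re :=
  (h.sum_trace_exit hρ n).trans_le (sub_le_self _ (h.isTraceClass_iterate hρ n).trace_nonneg)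

theorem summable_trace_exit (h : IsQuantumLoop M₀ M₁ 𝓔) (hρ : IsTraceClass ρ) :
    Summable fun n => (trace (sandwich M₀ ((loopStep M₁ 𝓔)^[n] ρ))).re :=
  summable_of_sum_range_le (fun n => (h.isTraceClass_exit hρ n).trace_nonneg)
    (h.sum_trace_exit_le hρ)

theorem isOperation_denote (h : IsQuantumLoop M₀ M₁ 𝓔) :
    IsOperation (denote (.loop M₀ M₁ (.apply 𝓔))) := by
  rw [funext (denote_loop M₀ M₁ 𝓔)]
  exact .tsum (fun n => (isOperation_sandwich h.norm_exit_le).comp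
      (h.isOperation_loopStep.iterate n)) h.summable_trace_exit
    fun hρ => Real.tsum_le_of_sum_range_le (fun n => (h.isTraceClass_exit hρ n).trace_nonneg)
      (h.sum_trace_exit_le hρ)

theorem hasSum_trace_exit_comp (h : IsQuantumLoop M₀ M₁ 𝓔) (hρ : IsTraceClass ρ) (A : Op E) :
    HasSum (fun n => (trace (sandwich M₀ ((loopStep M₁ 𝓔)^[n] ρ) ∘L A)).re)
      (trace (denote (.loop M₀ M₁ (.apply 𝓔)) ρ ∘L A)).re := by
  rw [denote_loop]
  exact Complex.hasSum_re
    (IsTraceClass.hasSum_trace_comp_tsum (h.isTraceClass_exit hρ) (h.summable_trace_exit hρ) A)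

theorem sat_denote_iff (h : IsQuantumLoop M₀ M₁ 𝓔) (hρ : IsTraceClass ρ) :
    Sat (denote (.loop M₀ M₁ (.apply 𝓔)) ρ) q ↔
      ∀ n, Sat ((loopStep M₁ 𝓔)^[n] ρ) (q.comap M₀) := by
  rw [denote_loop, IsTraceClass.sat_tsum_iff (h.isTraceClass_exit hρ) (h.summable_trace_exit hρ)]
  simp only [(h.isTraceClass_iterate hρ _).sat_sandwich_iff]

theorem tendsto_trace_iterate (h : IsQuantumLoop M₀ M₁ 𝓔) (hρ : IsTraceClass ρ) :
    Tendsto (fun n => (trace ((loopStep M₁ 𝓔)^[n] ρ)).re) atTop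
      (𝓝 ((trace ρ).re - (trace (denote (.loop M₀ M₁ (.apply 𝓔)) ρ)).re)) := by
  have hlim := (Complex.hasSum_re (IsTraceClass.hasSum_trace_tsum (h.isTraceClass_exit hρ)
    (h.summable_trace_exit hρ))).tendsto_sum_nat
  simp only [h.sum_trace_exit hρ, ← denote_loop] at hlim
  simpa using hlim.const_sub (trace ρ).re

theorem trace_denote_eq_iff (h : IsQuantumLoop M₀ M₁ 𝓔) (hρ : IsTraceClass ρ) :
    trace (denote (.loop M₀ M₁ (.apply 𝓔)) ρ) = trace ρ ↔
      Tendsto (fun n => (trace ((loopStep M₁ 𝓔)^[n] ρ)).re) atTop (𝓝 0) := by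
  have hlim := h.tendsto_trace_iterate hρ
  rw [hρ.trace_eq_iff (h.isOperation_denote.isTraceClass hρ)]
  refine ⟨fun heq => by rwa [heq, sub_self] at hlim, fun hzero => ?_⟩
  linarith [tendsto_nhds_unique hlim hzero]

theorem sat_denote_iff_loopStep (h : IsQuantumLoop M₀ M₁ 𝓔) (hρ : IsTraceClass ρ) :
    Sat (denote (.loop M₀ M₁ (.apply 𝓔)) ρ) q ↔
      Sat ρ (q.comap M₀) ∧ Sat (denote (.loop M₀ M₁ (.apply 𝓔)) (loopStep M₁ 𝓔 ρ)) q := by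
  rw [h.sat_denote_iff hρ, h.sat_denote_iff (h.isOperation_loopStep.isTraceClass hρ),
    ← Nat.and_forall_add_one]
  rfl

theorem trace_denote_loopStep_iff (h : IsQuantumLoop M₀ M₁ 𝓔) (hρ : IsTraceClass ρ) :
    trace (denote (.loop M₀ M₁ (.apply 𝓔)) (loopStep M₁ 𝓔 ρ)) = trace (loopStep M₁ 𝓔 ρ) ↔
      trace (denote (.loop M₀ M₁ (.apply 𝓔)) ρ) = trace ρ := by
  rw [h.trace_denote_eq_iff hρ, h.trace_denote_eq_iff (h.isOperation_loopStep.isTraceClass hρ)]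
  exact tendsto_add_atTop_iff_nat (f := fun n => (trace ((loopStep M₁ 𝓔)^[n] ρ)).re) 1

theorem sat_iterate (h : IsQuantumLoop M₀ M₁ 𝓔)
    (hr : ∀ σ ∈ PartialDensity E, Sat σ r → Sat (loopStep M₁ 𝓔 σ) r)
    (hρ : ρ ∈ PartialDensity E) (hsat : Sat ρ r) (n : ℕ) : Sat ((loopStep M₁ 𝓔)^[n] ρ) r := by
  induction n with
  | zero => exact hsat
  | succ n ih =>
    rw [Function.iterate_succ_apply']
    exact hr _ ((h.isOperation_loopStep.iterate n).mem_partialDensity hρ) ih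

theorem sat_denote_of_invariant (h : IsQuantumLoop M₀ M₁ 𝓔)
    (hr : ∀ σ ∈ PartialDensity E, Sat σ r → Sat (loopStep M₁ 𝓔 σ) r) (hrq : r ≤ q.comap M₀)
    (hρ : ρ ∈ PartialDensity E) (hsat : Sat ρ r) :
    Sat (denote (.loop M₀ M₁ (.apply 𝓔)) ρ) q :=
  (h.sat_denote_iff (isTraceClass_of_mem hρ)).2 fun n => (h.sat_iterate hr hρ hsat n).trans hrq

theorem exists_trace_iterate_lt_of_isRanking (h : IsQuantumLoop M₀ M₁ 𝓔) {ε : ℝ} {t : Op E → ℕ}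
    (ht : IsRanking (.apply 𝓔) M₁ r ε t) (hρ : ρ ∈ PartialDensity E) (hsat : Sat ρ r) :
    ∃ n, (trace ((loopStep M₁ 𝓔)^[n] ρ)).re < ε := by
  simp only [IsRanking, denote_apply] at ht
  by_contra! hge
  have hbound : ∀ n, t ((loopStep M₁ 𝓔)^[n] ρ) + n ≤ t ρ := fun n => by
    induction n with
    | zero => simp
    | succ n ih =>
      have hlt := (ht _ ((h.isOperation_loopStep.iterate n).mem_partialDensity hρ)
        (h.sat_iterate (fun σ hσ hs => (ht σ hσ hs).1) hρ hsat n)).2.2 (hge n)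
      rw [Function.iterate_succ_apply', loopStep]
      omega
  have := hbound (t ρ + 1)
  omega

theorem trace_denote_of_isRanking (h : IsQuantumLoop M₀ M₁ 𝓔) {t : ℝ → Op E → ℕ}
    (ht : ∀ ε : ℝ, 0 < ε → IsRanking (.apply 𝓔) M₁ r ε (t ε)) (hρ : ρ ∈ PartialDensity E)
    (hsat : Sat ρ r) : trace (denote (.loop M₀ M₁ (.apply 𝓔)) ρ) = trace ρ := by
  have hρ' := isTraceClass_of_mem hρ
  rw [h.trace_denote_eq_iff hρ']
  refine tendsto_order.2 ⟨fun ε hε => .of_forall fun n =>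
    hε.trans_le (h.isTraceClass_iterate hρ' n).trace_nonneg, fun ε hε => ?_⟩
  obtain ⟨n, hn⟩ := h.exists_trace_iterate_lt_of_isRanking (ht ε hε) hρ hsat
  filter_upwards [eventually_ge_atTop n] with m hm
  exact (h.antitone_trace_iterate hρ' hm).trans_lt hn

end IsQuantumLoop

/-- The number of rounds until the probability of still being inside the loop drops below `ε`;
junk value `0` if it never does. -/
def loopRank (M₁ : Op E) (𝓔 : Op E → Op E) (ε : ℝ) (ρ : Op E) : ℕ :=
  sInf {n | (trace ((loopStep M₁ 𝓔)^[n] ρ)).re < ε}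

namespace IsQuantumLoop

theorem loopRank_loopStep (h : IsQuantumLoop M₀ M₁ 𝓔) {ε : ℝ} (hε : 0 < ε) (hρ : IsTraceClass ρ)
    (hlim : Tendsto (fun n => (trace ((loopStep M₁ 𝓔)^[n] ρ)).re) atTop (𝓝 0)) :
    loopRank M₁ 𝓔 ε (loopStep M₁ 𝓔 ρ) ≤ loopRank M₁ 𝓔 ε ρ ∧
      (ε ≤ (trace ρ).re → loopRank M₁ 𝓔 ε (loopStep M₁ 𝓔 ρ) < loopRank M₁ 𝓔 ε ρ) := by
  have hmem : (trace ((loopStep M₁ 𝓔)^[loopRank M₁ 𝓔 ε ρ] ρ)).re < ε :=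
    Nat.sInf_mem (hlim.eventually_lt_const hε).exists
  rcases hn : loopRank M₁ 𝓔 ε ρ with _ | n <;> rw [hn] at hmem
  · refine ⟨Nat.sInf_le ?_, fun hge => absurd hmem hge.not_gt⟩
    exact (h.antitone_trace_iterate hρ zero_le_one).trans_lt hmem
  · have hle : loopRank M₁ 𝓔 ε (loopStep M₁ 𝓔 ρ) ≤ n := Nat.sInf_le hmem
    exact ⟨hle.trans n.le_succ, fun _ => Nat.lt_succ_of_le hle⟩

theorem isRanking_loopRank (h : IsQuantumLoop M₀ M₁ 𝓔)
    (hr : ∀ σ ∈ PartialDensity E, Sat σ r → Sat (loopStep M₁ 𝓔 σ) r)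
    (hlossless : r ≤ h.isOperation_denote.losslessSpace) {ε : ℝ} (hε : 0 < ε) :
    IsRanking (.apply 𝓔) M₁ r ε (loopRank M₁ 𝓔 ε) := by
  intro σ hσ hsat
  have hσ' := isTraceClass_of_mem hσ
  rw [denote_apply]
  refine ⟨hr σ hσ hsat, h.loopRank_loopStep hε hσ' ?_⟩
  rw [← h.trace_denote_eq_iff hσ', ← h.isOperation_denote.sat_losslessSpace_iff hσ']
  exact hsat.trans hlossless

end IsQuantumLoop

end Loops

/-! ### Block diagonal operators and atomic propositions -/

section Blocks

variable {H : Type*} [NormedAddCommGroup H] [InnerProductSpace ℂ H] {L : Type*}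

theorem joint_ext_iff {ψ φ : Joint H L} : ψ = φ ↔ ∀ l, bra l ψ = bra l φ :=
  ⟨fun h _ => h ▸ rfl, PiLp.ext⟩

theorem mem_block {P : L → ClosedSubmodule ℂ H} {ψ : Joint H L} :
    ψ ∈ block P ↔ ∀ l, bra l ψ ∈ P l := by
  simp [block]

theorem inf_mem_AP {p q : ClosedSubmodule ℂ (Joint H L)} (hp : p ∈ AP H L) (hq : q ∈ AP H L) :
    p ⊓ q ∈ AP H L := by
  obtain ⟨P, rfl⟩ := hp
  obtain ⟨Q, rfl⟩ := hq
  refine ⟨P ⊓ Q, SetLike.ext fun ψ => ?_⟩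
  simp only [ClosedSubmodule.mem_inf, mem_block, Pi.inf_apply, forall_and]

variable [Fintype L]

theorem norm_sq_eq_sum_bra (ψ : Joint H L) : ‖ψ‖ ^ 2 = ∑ l, ‖bra l ψ‖ ^ 2 :=
  PiLp.norm_sq_eq_of_L2 _ _

variable [CompleteSpace H]

theorem ketbra_eq_sandwich (A : Op H) (l : L) : ketbra A l l = sandwich (adjoint (bra l)) A := by
  rw [ketbra, sandwich, adjoint_adjoint]

theorem ketbra_add (A B : Op H) (k l : L) : ketbra (A + B) k l = ketbra A k l + ketbra B k l := by
  simp only [ketbra, add_comp, comp_add]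

theorem IsTraceClass.ketbra {ρ : Op H} (h : IsTraceClass ρ) (l : L) :
    IsTraceClass (QTLogic.ketbra ρ l l) :=
  ketbra_eq_sandwich ρ l ▸ h.sandwich _

theorem IsTraceClass.sum_trace_sandwich_bra {σ : Op (Joint H L)} (h : IsTraceClass σ) :
    ∑ l, trace (QTLogic.sandwich (bra l) σ) = trace σ :=
  h.sum_trace_sandwich fun ψ => (norm_sq_eq_sum_bra ψ).symm

/-- The block diagonal part `∑ₗ ⟨l|σ|l⟩ ⊗ |l⟩⟨l|`, all that an exit program sees of its state. -/
def dephase (σ : Op (Joint H L)) : Op (Joint H L) := ∑ l, ketbra (sandwich (bra l) σ) l l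

theorem IsTraceClass.dephase {σ : Op (Joint H L)} (h : IsTraceClass σ) :
    IsTraceClass (QTLogic.dephase σ) :=
  .sum fun l => (h.sandwich (bra l)).ketbra l

theorem adjoint_bra_apply [DecidableEq L] (l : L) (x : H) :
    adjoint (bra l) x = (WithLp.toLp 2 (Pi.single l x) : Joint H L) := by
  refine ext_inner_right ℂ fun v => ?_
  rw [adjoint_inner_left, PiLp.inner_apply, Finset.sum_eq_single l]
  · simp [bra]
  · intro k _ hk
    simp [hk]
  · simp

theorem bra_adjoint_bra [DecidableEq L] (k l : L) (x : H) :
    bra k (adjoint (bra l) x) = if k = l then x else 0 := by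
  rw [adjoint_bra_apply]
  simp [bra]

theorem bra_ketbra [DecidableEq L] (A : Op H) (m k l : L) (ψ : Joint H L) :
    bra m (ketbra A k l ψ) = if m = k then A (bra l ψ) else 0 :=
  bra_adjoint_bra _ _ _

theorem sum_ketbra_one (ψ : Joint H L) : ∑ l, ketbra 1 l l ψ = ψ :=
  joint_ext_iff.2 fun k => by
    classical
    simp [map_sum, bra_ketbra]

theorem norm_adjoint_bra (l : L) (x : H) : ‖adjoint (bra l) x‖ = ‖x‖ := by
  classical
  rw [← sq_eq_sq₀ (norm_nonneg _) (norm_nonneg _), norm_sq_eq_sum_bra]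
  simp [bra_adjoint_bra, apply_ite]

theorem trace_ketbra {ρ : Op H} (h : IsTraceClass ρ) (l : L) : trace (ketbra ρ l l) = trace ρ := by
  rw [ketbra_eq_sandwich]
  simpa using h.sum_trace_sandwich (K := Unit) (A := fun _ => adjoint (bra l)) fun x => by
    simp [norm_adjoint_bra]

theorem sandwich_bra_ketbra [DecidableEq L] (A : Op H) (k l : L) :
    sandwich (bra k) (ketbra A l l) = if k = l then A else 0 := by
  have hcomp : (bra k ∘L adjoint (bra l) : Op H) = if k = l then 1 else 0 := by
    ext x
    rw [comp_apply, bra_adjoint_bra]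
    split_ifs <;> rfl
  rw [ketbra_eq_sandwich, sandwich_sandwich, hcomp]
  split_ifs
  · exact sandwich_one A
  · exact sandwich_zero_left A

theorem mem_AP_iff {p : ClosedSubmodule ℂ (Joint H L)} :
    p ∈ AP H L ↔ ∀ ψ ∈ p, ∀ l, ketbra 1 l l ψ ∈ p := by
  classical
  constructor
  · rintro ⟨P, rfl⟩ ψ hψ l
    rw [mem_block] at hψ ⊢
    intro k
    rw [bra_ketbra]
    split_ifs with h
    · exact h ▸ hψ k
    · exact (P k).toSubmodule.zero_mem
  · intro h
    refine ⟨fun l => p.comap (adjoint (bra l)), le_antisymm (fun ψ hψ => ?_) fun ψ hψ => ?_⟩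
    · rw [mem_block] at hψ
      rw [← sum_ketbra_one ψ]
      exact p.toSubmodule.sum_mem fun l _ => hψ l
    · exact mem_block.2 (h ψ hψ)

theorem sandwich_bra_dephase (l : L) (σ : Op (Joint H L)) :
    sandwich (bra l) (dephase σ) = sandwich (bra l) σ := by
  classical
  simp only [dephase, sandwich_sum, sandwich_bra_ketbra, Finset.sum_ite_eq, Finset.mem_univ,
    if_true]

theorem trace_dephase {σ : Op (Joint H L)} (h : IsTraceClass σ) :
    trace (dephase σ) = trace σ := by
  rw [← h.dephase.sum_trace_sandwich_bra, ← h.sum_trace_sandwich_bra]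
  simp only [sandwich_bra_dephase]

theorem mem_AP_of_sat_dephase {p : ClosedSubmodule ℂ (Joint H L)}
    (h : ∀ σ, IsTraceClass σ → Sat σ p → Sat (dephase σ) p) : p ∈ AP H L :=
  mem_AP_iff.2 fun ψ hψ l => by
    have hψ' := isTraceClass_rankOne ψ
    have hsat := h _ hψ' (sat_rankOne_iff.2 hψ)
    rw [dephase, IsTraceClass.sat_sum_iff fun l => (hψ'.sandwich (bra l)).ketbra l] at hsat
    have := hsat l (Finset.mem_univ l)
    rwa [ketbra_eq_sandwich, (hψ'.sandwich _).sat_sandwich_iff, hψ'.sat_sandwich_iff,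
      sat_rankOne_iff] at this

theorem IsOperation.wlp_mem_AP {F : Type*} [NormedAddCommGroup F] [InnerProductSpace ℂ F]
    [CompleteSpace F] {𝓔 : Op (Joint H L) → Op F} (h : IsOperation 𝓔)
    (hdephase : ∀ σ, 𝓔 (dephase σ) = 𝓔 σ) (q : ClosedSubmodule ℂ F) : h.wlp q ∈ AP H L :=
  mem_AP_of_sat_dephase fun σ hσ => by
    rw [h.sat_wlp_iff hσ, h.sat_wlp_iff hσ.dephase, hdephase]
    exact id

theorem IsOperation.losslessSpace_mem_AP {F : Type*} [NormedAddCommGroup F]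
    [InnerProductSpace ℂ F] [CompleteSpace F] {𝓔 : Op (Joint H L) → Op F} (h : IsOperation 𝓔)
    (hdephase : ∀ σ, 𝓔 (dephase σ) = 𝓔 σ) : h.losslessSpace ∈ AP H L :=
  mem_AP_of_sat_dephase fun σ hσ => by
    rw [h.sat_losslessSpace_iff hσ, h.sat_losslessSpace_iff hσ.dephase, hdephase, trace_dephase hσ]
    exact id

end Blocks

/-! ### One step of a program with exit -/

section Channels

variable {E : Type*} [NormedAddCommGroup E] [InnerProductSpace ℂ E]

theorem Channel.norm_kraus_le (C : Channel E) (k : ℕ) (x : E) : ‖C.kraus k x‖ ≤ ‖x‖ :=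
  le_of_sq_le_sq (le_hasSum (C.tracePreserving x) k fun _ _ => sq_nonneg _) (norm_nonneg x)

variable [CompleteSpace E]

theorem Channel.trace_apply (C : Channel E) {ρ : Op E} (hρ : IsTraceClass ρ) :
    trace (C.apply ρ) = trace ρ := by
  have hsum := hρ.hasSum_trace_sandwich C.tracePreserving
  have htc := fun k => hρ.sandwich (C.kraus k)
  rw [Channel.apply, hρ.trace_eq_iff (.tsum htc hsum.summable)]
  exact (Complex.hasSum_re (IsTraceClass.hasSum_trace_tsum htc hsum.summable)).unique hsum

theorem Channel.isOperation (C : Channel E) : IsOperation C.apply :=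
  .tsum (fun k => isOperation_sandwich (C.norm_kraus_le k))
    (fun hρ => (hρ.hasSum_trace_sandwich C.tracePreserving).summable)
    fun hρ => (hρ.hasSum_trace_sandwich C.tracePreserving).tsum_eq.le

end Channels

namespace ExitProgram

variable {H : Type*} [NormedAddCommGroup H] [InnerProductSpace ℂ H] [CompleteSpace H]
variable {L : Type*} (π : ExitProgram H L)

theorem sum_norm_sq_meas (l : L) (x : H) : ∑ j, ‖π.meas l j x‖ ^ 2 = ‖x‖ ^ 2 := by
  have h := congrArg (fun A : Op H => (⟪x, A x⟫_ℂ).re) (π.meas_complete l)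
  simpa [sum_apply, inner_sum, adjoint_inner_right, inner_self_eq_norm_sq_to_K,
    ← Complex.ofReal_pow] using h

variable [Fintype L]

/-- The contribution `∑ⱼ (M_{l,j} ℰ_l(τ) M_{l,j}†) ⊗ |f(j,l)⟩⟨f(j,l)|` of the location `l` to one
step of the program. -/
def stepAt (l : L) (τ : Op H) : Op (Joint H L) :=
  ∑ j, ketbra (sandwich (π.meas l j) ((π.act l).apply τ)) (π.goto j l) (π.goto j l)

theorem step_eq_sum_stepAt (σ : Op (Joint H L)) :
    π.step σ = ∑ l, π.stepAt l (sandwich (bra l) σ) :=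
  Finset.sum_comm

theorem isTraceClass_stepAt {τ : Op H} (hτ : IsTraceClass τ) (l : L) :
    IsTraceClass (π.stepAt l τ) :=
  .sum fun j => (((π.act l).isOperation.isTraceClass hτ).sandwich (π.meas l j)).ketbra _

theorem stepAt_add {τ τ' : Op H} (hτ : IsTraceClass τ) (hτ' : IsTraceClass τ') (l : L) :
    π.stepAt l (τ + τ') = π.stepAt l τ + π.stepAt l τ' := by
  simp only [stepAt, (π.act l).isOperation.map_add hτ hτ', sandwich_add, ketbra_add,
    Finset.sum_add_distrib]

theorem stepAt_zero (l : L) : π.stepAt l 0 = 0 := by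
  simpa using π.stepAt_add .zero .zero l

theorem trace_stepAt {τ : Op H} (hτ : IsTraceClass τ) (l : L) :
    trace (π.stepAt l τ) = trace τ := by
  have hact := (π.act l).isOperation.isTraceClass hτ
  rw [stepAt, IsTraceClass.trace_sum fun j => (hact.sandwich (π.meas l j)).ketbra _,
    ← (π.act l).trace_apply hτ, ← hact.sum_trace_sandwich (π.sum_norm_sq_meas l)]
  exact Finset.sum_congr rfl fun j _ => trace_ketbra (hact.sandwich _) _

theorem stepAt_exit {τ : Op H} (hτ : τ ∈ PartialDensity H) :
    π.stepAt π.exit τ = ketbra τ π.exit π.exit := by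
  rw [stepAt, π.act_exit τ hτ, Fintype.sum_eq_single 0, π.goto_exit, π.meas_exit, if_pos rfl,
    sandwich_one]
  intro j hj
  rw [π.meas_exit, if_neg hj, sandwich_zero_left]
  simp only [ketbra, zero_comp, comp_zero]

theorem trace_step {σ : Op (Joint H L)} (hσ : IsTraceClass σ) :
    trace (π.step σ) = trace σ := by
  rw [step_eq_sum_stepAt, IsTraceClass.trace_sum fun l =>
    π.isTraceClass_stepAt (hσ.sandwich (bra l)) l, ← hσ.sum_trace_sandwich_bra]
  exact Finset.sum_congr rfl fun l _ => π.trace_stepAt (hσ.sandwich _) l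

theorem isOperation_step : IsOperation π.step where
  isTraceClass hσ := by
    rw [step_eq_sum_stepAt]
    exact .sum fun l => π.isTraceClass_stepAt (hσ.sandwich (bra l)) l
  map_add hσ hτ := by
    simp only [step_eq_sum_stepAt, sandwich_add, ← Finset.sum_add_distrib,
      π.stepAt_add (hσ.sandwich _) (hτ.sandwich _)]
  trace_le hσ := (congrArg Complex.re (π.trace_step hσ)).le

/-! ### The while-program form -/

theorem sandwich_M₀ (σ : Op (Joint H L)) :
    sandwich π.M₀ σ = ketbra (sandwich (bra π.exit) σ) π.exit π.exit := by
  simp [sandwich, M₀, ketbra, adjoint_comp, one_def, comp_assoc]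

variable {p q : ClosedSubmodule ℂ (Joint H L)} {σ : Op (Joint H L)}

theorem le_comap_M₀ (hp : p ∈ AP H L) : p ≤ p.comap π.M₀ := fun ψ hψ => mem_AP_iff.1 hp ψ hψ _

variable [DecidableEq L]

theorem bra_M₀ (l : L) (ψ : Joint H L) :
    bra l (π.M₀ ψ) = if l = π.exit then bra l ψ else 0 := by
  rw [M₀, bra_ketbra]
  split_ifs with h
  · rw [h, one_apply_eq_self]
  · rfl

theorem M₀_add_M₁ (ψ : Joint H L) : π.M₀ ψ + π.M₁ ψ = ψ := by
  rw [M₀, M₁, sum_apply, Finset.add_sum_erase _ (fun l => ketbra 1 l l ψ) (Finset.mem_univ _),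
    sum_ketbra_one]

theorem bra_M₁ (l : L) (ψ : Joint H L) :
    bra l (π.M₁ ψ) = if l = π.exit then 0 else bra l ψ := by
  have hM₁ : π.M₁ ψ = ψ - π.M₀ ψ := eq_sub_of_add_eq' (π.M₀_add_M₁ ψ)
  rw [hM₁, map_sub, bra_M₀]
  split_ifs <;> simp

theorem mem_exitSpace {ψ : Joint H L} : ψ ∈ π.exitSpace ↔ π.M₁ ψ = 0 := by
  rw [exitSpace, mem_block, joint_ext_iff]
  refine forall_congr' fun l => ?_
  rw [bra_M₁]
  split_ifs <;> simp

theorem mem_runSpace {ψ : Joint H L} : ψ ∈ π.runSpace ↔ π.M₀ ψ = 0 := by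
  rw [runSpace, mem_block, joint_ext_iff]
  refine forall_congr' fun l => ?_
  rw [bra_M₀]
  split_ifs <;> simp

theorem M₀_mem_exitSpace (ψ : Joint H L) : π.M₀ ψ ∈ π.exitSpace :=
  π.mem_exitSpace.2 <| joint_ext_iff.2 fun l => by rw [bra_M₁, bra_M₀]; split_ifs <;> simp

theorem M₁_mem_runSpace (ψ : Joint H L) : π.M₁ ψ ∈ π.runSpace :=
  π.mem_runSpace.2 <| joint_ext_iff.2 fun l => by rw [bra_M₀, bra_M₁]; split_ifs <;> simp

theorem M₀_eq_self {ψ : Joint H L} (h : ψ ∈ π.exitSpace) : π.M₀ ψ = ψ := by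
  simpa only [π.mem_exitSpace.1 h, add_zero] using π.M₀_add_M₁ ψ

theorem M₁_eq_self {ψ : Joint H L} (h : ψ ∈ π.runSpace) : π.M₁ ψ = ψ := by
  simpa only [π.mem_runSpace.1 h, zero_add] using π.M₀_add_M₁ ψ

theorem norm_sq_M₀_add_norm_sq_M₁ (ψ : Joint H L) : ‖π.M₀ ψ‖ ^ 2 + ‖π.M₁ ψ‖ ^ 2 = ‖ψ‖ ^ 2 := by
  simp only [norm_sq_eq_sum_bra, ← Finset.sum_add_distrib, bra_M₀, bra_M₁]
  exact Finset.sum_congr rfl fun l _ => by split_ifs <;> simp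

theorem isQuantumLoop : IsQuantumLoop π.M₀ π.M₁ π.step where
  norm_sq_add_norm_sq := π.norm_sq_M₀_add_norm_sq_M₁
  isOperation := π.isOperation_step
  trace_apply := π.trace_step

theorem isOperation_denote : IsOperation (denote π.whileForm) := π.isQuantumLoop.isOperation_denote

theorem comap_M₀_inf_comap_M₁ :
    q.comap π.M₀ ⊓ p.comap π.M₁ = (π.exitSpace ⊓ q) ⊔ (π.runSpace ⊓ p) := by
  refine le_antisymm (fun ψ hψ => ?_)
    (sup_le (fun ψ hψ => ⟨?_, ?_⟩) fun ψ hψ => ⟨?_, ?_⟩)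
  · rw [← π.M₀_add_M₁ ψ]
    exact add_mem
      ((le_sup_left : _ ≤ (π.exitSpace ⊓ q) ⊔ (π.runSpace ⊓ p)) ⟨π.M₀_mem_exitSpace ψ, hψ.1⟩)
      ((le_sup_right : _ ≤ (π.exitSpace ⊓ q) ⊔ (π.runSpace ⊓ p)) ⟨π.M₁_mem_runSpace ψ, hψ.2⟩)
  · exact (congrArg (· ∈ q) (π.M₀_eq_self hψ.1)).mpr hψ.2
  · exact (congrArg (· ∈ p) (π.mem_exitSpace.1 hψ.1)).mpr (zero_mem p)
  · exact (congrArg (· ∈ q) (π.mem_runSpace.1 hψ.1)).mpr (zero_mem q)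
  · exact (congrArg (· ∈ p) (π.M₁_eq_self hψ.1)).mpr hψ.2

theorem inv_eq (p q : ClosedSubmodule ℂ (Joint H L)) :
    π.inv p q = q.comap π.M₀ ⊓ p.comap π.M₁ := by
  rw [inv, supp_proj_add_proj, comap_M₀_inf_comap_M₁]

theorem runSpace_sup_eq (q : ClosedSubmodule ℂ (Joint H L)) :
    π.runSpace ⊔ (π.exitSpace ⊓ q) = q.comap π.M₀ := by
  have h := π.comap_M₀_inf_comap_M₁ (p := ⊤) (q := q)
  have htop : (⊤ : ClosedSubmodule ℂ (Joint H L)).comap π.M₁ = ⊤ := rfl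
  rwa [inf_top_eq, sup_comm, htop, inf_top_eq, eq_comm] at h

theorem le_comap_M₁ (hp : p ∈ AP H L) : p ≤ p.comap π.M₁ := fun ψ hψ => by
  rw [ClosedSubmodule.mem_comap, M₁, sum_apply]
  exact sum_mem fun l _ => mem_AP_iff.1 hp ψ hψ l

theorem sandwich_bra_sandwich_M₁ (l : L) (σ : Op (Joint H L)) :
    sandwich (bra l) (sandwich π.M₁ σ) = if l = π.exit then 0 else sandwich (bra l) σ := by
  have hcomp : (bra l ∘L π.M₁ : Joint H L →L[ℂ] H) = if l = π.exit then 0 else bra l := by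
    ext ψ
    rw [comp_apply, bra_M₁]
    split_ifs <;> rfl
  rw [sandwich_sandwich, hcomp]
  split_ifs
  · exact sandwich_zero_left σ
  · rfl

theorem loopStep_eq_sum_stepAt (σ : Op (Joint H L)) :
    loopStep π.M₁ π.step σ =
      ∑ l, if l = π.exit then 0 else π.stepAt l (sandwich (bra l) σ) := by
  rw [loopStep, step_eq_sum_stepAt]
  refine Finset.sum_congr rfl fun l _ => ?_
  rw [sandwich_bra_sandwich_M₁]
  split_ifs
  · exact π.stepAt_zero l
  · rfl

theorem step_eq (hσ : σ ∈ PartialDensity (Joint H L)) :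
    π.step σ = loopStep π.M₁ π.step σ + sandwich π.M₀ σ := by
  have hexit : sandwich (bra π.exit) σ ∈ PartialDensity H :=
    (isOperation_sandwich fun ψ => PiLp.norm_apply_le ψ π.exit).mem_partialDensity hσ
  rw [loopStep_eq_sum_stepAt, sandwich_M₀, ← π.stepAt_exit hexit, step_eq_sum_stepAt,
    Finset.sum_ite, Finset.sum_const_zero, zero_add, Finset.filter_ne', Finset.sum_erase_add]
  exact Finset.mem_univ _

theorem loopStep_sandwich_M₁ (σ : Op (Joint H L)) :
    loopStep π.M₁ π.step (sandwich π.M₁ σ) = loopStep π.M₁ π.step σ := by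
  have hcomp : π.M₁ ∘L π.M₁ = π.M₁ := ext fun ψ => π.M₁_eq_self (π.M₁_mem_runSpace ψ)
  rw [loopStep, loopStep, sandwich_sandwich, hcomp]

theorem denote_whileForm_dephase (σ : Op (Joint H L)) :
    denote π.whileForm (dephase σ) = denote π.whileForm σ := by
  simp only [whileForm, body, denote_loop]
  refine tsum_congr fun n => ?_
  cases n with
  | zero => simp only [Function.iterate_zero, id_eq, sandwich_M₀, sandwich_bra_dephase]
  | succ n => simp only [Function.iterate_succ_apply, loopStep_eq_sum_stepAt, sandwich_bra_dephase]

end ExitProgram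

/-! ### The proof systems -/

namespace ExitProgram

variable {H : Type*} [NormedAddCommGroup H] [InnerProductSpace ℂ H] [CompleteSpace H]
variable {L : Type*} [Fintype L] (π : ExitProgram H L)
variable {P p q : ClosedSubmodule ℂ (Joint H L)} {σ : Op (Joint H L)}

theorem validTot_body_iff : ValidTot π.body p q ↔ ValidPar π.body p q := by
  simp only [ValidTot, ValidPar, body, denote_apply]
  exact forall₂_congr fun σ hσ => imp_congr_right fun _ =>
    and_iff_left (π.trace_step (isTraceClass_of_mem hσ))

variable [DecidableEq L]

theorem inv_le_comap_M₀ : π.inv p q ≤ q.comap π.M₀ :=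
  (π.inv_eq p q).trans_le inf_le_left

theorem inv_le_comap_M₁ : π.inv p q ≤ p.comap π.M₁ :=
  (π.inv_eq p q).trans_le inf_le_right

theorem sat_loopStep_of_validPar_body (h : ValidPar π.body p (π.inv p q))
    (hσ : σ ∈ PartialDensity (Joint H L)) (hsat : Sat σ (π.inv p q)) :
    Sat (loopStep π.M₁ π.step σ) (π.inv p q) := by
  have hM₁ : Sat (sandwich π.M₁ σ) p :=
    (isTraceClass_of_mem hσ).sat_sandwich_iff.2 (hsat.trans π.inv_le_comap_M₁)
  have hstep := h _ ((isOperation_sandwich π.isQuantumLoop.norm_guard_le).mem_partialDensity hσ) hM₁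
  rwa [body, denote_apply] at hstep

theorem validPar_of_provesPar {S : QWhile (Joint H L)} (h : π.ProvesPar S P q) :
    ValidPar S P q := by
  induction h with
  | basic _ _ h => exact h
  | invariant _ _ _ hbody =>
    exact fun ρ => π.isQuantumLoop.sat_denote_of_invariant
      (fun σ => π.sat_loopStep_of_validPar_body hbody) π.inv_le_comap_M₀
  | conseq _ _ hP _ hQ ih => exact fun ρ hρ hsat => (ih ρ hρ (hsat.trans hP)).trans hQ

theorem validTot_of_provesTot {S : QWhile (Joint H L)} (h : π.ProvesTot S P q) :
    ValidTot S P q := by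
  induction h with
  | basic _ _ h => exact h
  | ranking t _ _ _ ht hbody =>
    exact fun ρ hρ hsat => ⟨π.isQuantumLoop.sat_denote_of_invariant
      (fun σ => π.sat_loopStep_of_validPar_body (π.validTot_body_iff.1 hbody))
      π.inv_le_comap_M₀ hρ hsat, π.isQuantumLoop.trace_denote_of_isRanking ht hρ hsat⟩
  | conseq _ _ hP _ hQ ih =>
    exact fun ρ hρ hsat => (ih ρ hρ (hsat.trans hP)).imp_left fun h => h.trans hQ

theorem validPar_body_of_sat_loopStep (hp : p ∈ AP H L)
    (h : ∀ σ ∈ PartialDensity (Joint H L), Sat σ p → Sat (loopStep π.M₁ π.step σ) p) :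
    ValidPar π.body p p := by
  intro σ hσ hsat
  have hσ' := isTraceClass_of_mem hσ
  rw [body, denote_apply, π.step_eq hσ, IsTraceClass.sat_add_iff
    (π.isQuantumLoop.isOperation_loopStep.isTraceClass hσ') (hσ'.sandwich _)]
  exact ⟨h σ hσ hsat, hσ'.sat_sandwich_iff.2 (hsat.trans (π.le_comap_M₀ hp))⟩

theorem wlp_mem_AP (q : ClosedSubmodule ℂ (Joint H L)) : π.isOperation_denote.wlp q ∈ AP H L :=
  π.isOperation_denote.wlp_mem_AP π.denote_whileForm_dephase q

theorem losslessSpace_mem_AP : π.isOperation_denote.losslessSpace ∈ AP H L :=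
  π.isOperation_denote.losslessSpace_mem_AP π.denote_whileForm_dephase

theorem sat_wlp_iff_loopStep (hσ : IsTraceClass σ) :
    Sat σ (π.isOperation_denote.wlp q) ↔
      Sat σ (q.comap π.M₀) ∧ Sat (loopStep π.M₁ π.step σ) (π.isOperation_denote.wlp q) := by
  rw [π.isOperation_denote.sat_wlp_iff hσ, π.isOperation_denote.sat_wlp_iff
    (π.isQuantumLoop.isOperation_loopStep.isTraceClass hσ)]
  exact π.isQuantumLoop.sat_denote_iff_loopStep hσ

theorem sat_losslessSpace_iff_loopStep (hσ : IsTraceClass σ) :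
    Sat σ π.isOperation_denote.losslessSpace ↔
      Sat (loopStep π.M₁ π.step σ) π.isOperation_denote.losslessSpace := by
  rw [π.isOperation_denote.sat_losslessSpace_iff hσ, π.isOperation_denote.sat_losslessSpace_iff
    (π.isQuantumLoop.isOperation_loopStep.isTraceClass hσ)]
  exact (π.isQuantumLoop.trace_denote_loopStep_iff hσ).symm

theorem inv_wlp (q : ClosedSubmodule ℂ (Joint H L)) :
    π.inv (π.isOperation_denote.wlp q) q = π.isOperation_denote.wlp q := by
  rw [inv_eq]
  refine le_antisymm (forall_sat_iff_le.1 fun σ hσ hsat => ?_)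
    (le_inf (forall_sat_iff_le.1 fun σ hσ hsat => ?_) (π.le_comap_M₁ (π.wlp_mem_AP q)))
  · have hσ' := isTraceClass_of_mem hσ
    have hM₁ : Sat (sandwich π.M₁ σ) (π.isOperation_denote.wlp q) :=
      hσ'.sat_sandwich_iff.2 (hsat.trans inf_le_right)
    rw [π.sat_wlp_iff_loopStep (hσ'.sandwich _), loopStep_sandwich_M₁] at hM₁
    exact (π.sat_wlp_iff_loopStep hσ').2 ⟨hsat.trans inf_le_left, hM₁.2⟩
  · exact ((π.sat_wlp_iff_loopStep (isTraceClass_of_mem hσ)).1 hsat).1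

theorem comap_M₁_losslessSpace :
    π.isOperation_denote.losslessSpace.comap π.M₁ = π.isOperation_denote.losslessSpace := by
  refine le_antisymm (forall_sat_iff_le.1 fun σ hσ hsat => ?_)
    (π.le_comap_M₁ π.losslessSpace_mem_AP)
  have hσ' := isTraceClass_of_mem hσ
  rwa [← hσ'.sat_sandwich_iff, π.sat_losslessSpace_iff_loopStep (hσ'.sandwich _),
    loopStep_sandwich_M₁, ← π.sat_losslessSpace_iff_loopStep hσ'] at hsat

theorem inv_wlp_inf_losslessSpace (q : ClosedSubmodule ℂ (Joint H L)) :
    π.inv (π.isOperation_denote.wlp q ⊓ π.isOperation_denote.losslessSpace) q =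
      π.isOperation_denote.wlp q ⊓ π.isOperation_denote.losslessSpace := by
  have hcomap : (π.isOperation_denote.wlp q ⊓ π.isOperation_denote.losslessSpace).comap π.M₁ =
      (π.isOperation_denote.wlp q).comap π.M₁ ⊓ π.isOperation_denote.losslessSpace.comap π.M₁ :=
    rfl
  rw [inv_eq, hcomap, comap_M₁_losslessSpace, ← inf_assoc, ← inv_eq, inv_wlp]

theorem provesPar_iff_le_wlp (hP : P ∈ AP H L) (hq : q ∈ AP H L) :
    π.ProvesPar π.whileForm P q ↔ P ≤ π.isOperation_denote.wlp q := by
  refine ⟨fun h => (validPar_iff_le_wlp _).1 (π.validPar_of_provesPar h), fun h => ?_⟩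
  have hW := π.wlp_mem_AP q
  have hbody : ValidPar π.body (π.isOperation_denote.wlp q) (π.isOperation_denote.wlp q) :=
    π.validPar_body_of_sat_loopStep hW fun σ hσ hsat =>
      ((π.sat_wlp_iff_loopStep (isTraceClass_of_mem hσ)).1 hsat).2
  have hloop := ProvesPar.invariant hW hq (q := q) <| by
    rw [inv_wlp]
    exact .basic hW hW hbody
  rw [inv_wlp] at hloop
  exact .conseq hP hq h hloop le_rfl

theorem provesTot_iff_le_wlp_inf (hP : P ∈ AP H L) (hq : q ∈ AP H L) :
    π.ProvesTot π.whileForm P q ↔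
      P ≤ π.isOperation_denote.wlp q ⊓ π.isOperation_denote.losslessSpace := by
  refine ⟨fun h => (validTot_iff_le_wlp_inf _).1 (π.validTot_of_provesTot h), fun h => ?_⟩
  set R := π.isOperation_denote.wlp q ⊓ π.isOperation_denote.losslessSpace
  have hinv : π.inv R q = R := π.inv_wlp_inf_losslessSpace q
  have hRAP : R ∈ AP H L := inf_mem_AP (π.wlp_mem_AP q) π.losslessSpace_mem_AP
  have hpres : ∀ σ ∈ PartialDensity (Joint H L), Sat σ R → Sat (loopStep π.M₁ π.step σ) R :=
    fun σ hσ hsat => le_inf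
      ((π.sat_wlp_iff_loopStep (isTraceClass_of_mem hσ)).1 (hsat.trans inf_le_left)).2
      ((π.sat_losslessSpace_iff_loopStep (isTraceClass_of_mem hσ)).1 (hsat.trans inf_le_right))
  have hbody := π.validTot_body_iff.2 (π.validPar_body_of_sat_loopStep hRAP hpres)
  have hloop := ProvesTot.ranking (π := π) (loopRank π.M₁ π.step) hRAP hq
    (by rw [hinv]; exact .basic hRAP hRAP hbody) fun ε hε => by
      rw [hinv]
      exact π.isQuantumLoop.isRanking_loopRank hpres inf_le_right hε
  rw [hinv] at hloop
  exact .conseq hP hq h hloop le_rfl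

end ExitProgram

/-! ### Temporal properties -/

section States

variable {H : Type*} [NormedAddCommGroup H] [InnerProductSpace ℂ H] [CompleteSpace H]
variable {L : Type*} [Fintype L] {P R : ClosedSubmodule ℂ (Joint H L)}
variable {σ : Op (Joint H L)}

theorem mem_partialDensity_of_mem_states (h : σ ∈ States H L) :
    σ ∈ PartialDensity (Joint H L) ∧ trace σ = 1 := by
  obtain ⟨ρ, hρ, h1, rfl⟩ := h
  have htc := fun l => (isTraceClass_of_mem (hρ l)).ketbra l
  have htr : trace (∑ l, ketbra (ρ l) l l) = 1 := by
    rw [IsTraceClass.trace_sum htc, ← h1]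
    exact Finset.sum_congr rfl fun l _ => trace_ketbra (isTraceClass_of_mem (hρ l)) l
  exact ⟨(IsTraceClass.sum htc).mem_partialDensity (by simp [htr]), htr⟩

theorem ketbra_mem_states {ρ : Op H} (hρ : ρ ∈ PartialDensity H) (h1 : trace ρ = 1) (l : L) :
    ketbra ρ l l ∈ States H L := by
  classical
  have h0 : trace (0 : Op H) = 0 := by simp [trace]
  refine ⟨Pi.single l ρ, fun k => ?_, ?_, ?_⟩
  · rcases eq_or_ne k l with rfl | hk
    · rwa [Pi.single_eq_same]
    · rw [Pi.single_eq_of_ne hk]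
      exact IsTraceClass.zero.mem_partialDensity (by simp [h0])
  · rw [Fintype.sum_eq_single l fun k hk => by rw [Pi.single_eq_of_ne hk, h0], Pi.single_eq_same,
      h1]
  · rw [Fintype.sum_eq_single l fun k hk => by simp [Pi.single_eq_of_ne hk, ketbra],
      Pi.single_eq_same]

theorem forall_states_sat_iff_le (hP : P ∈ AP H L) :
    (∀ σ ∈ States H L, Sat σ P → Sat σ R) ↔ P ≤ R := by
  refine ⟨fun h => ?_, fun h σ _ hs => hs.trans h⟩
  have hcomap : ∀ l : L, P.comap (adjoint (bra l)) ≤ R.comap (adjoint (bra l)) := fun l =>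
    le_of_forall_norm_eq_one fun x hx hx1 => by
      have hxtc := isTraceClass_rankOne x
      have htr : trace (rankOne ℂ x x) = 1 := by simp [trace_rankOne, hx1]
      have hsat := h _ (ketbra_mem_states (hxtc.mem_partialDensity (by simp [htr])) htr l)
      simp only [ketbra_eq_sandwich, hxtc.sat_sandwich_iff, sat_rankOne_iff] at hsat
      exact hsat hx
  intro ψ hψ
  rw [← sum_ketbra_one ψ]
  exact sum_mem fun l _ => hcomap l (mem_AP_iff.1 hP ψ hψ l)

end States

theorem forall_exists_lt_sum_range_iff {f : ℕ → ℝ} {a b : ℝ} (hf : ∀ n, 0 ≤ f n)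
    (hsum : HasSum f a) :
    (∀ δ > 0, ∃ n, b - δ < ∑ m ∈ Finset.range (n + 1), f m) ↔ b ≤ a := by
  refine ⟨fun h => le_of_forall_pos_le_add fun δ hδ => ?_, fun h δ hδ => ?_⟩
  · obtain ⟨n, hn⟩ := h δ hδ
    linarith [sum_le_hasSum (Finset.range (n + 1)) (fun m _ => hf m) hsum]
  · exact (((tendsto_add_atTop_iff_nat 1).2 hsum.tendsto_sum_nat).eventually_const_lt
      (by linarith)).exists

namespace ExitProgram

variable {H : Type*} [NormedAddCommGroup H] [InnerProductSpace ℂ H] [CompleteSpace H]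
variable {L : Type*} [Fintype L] (π : ExitProgram H L)
variable {P q : ClosedSubmodule ℂ (Joint H L)} {σ : Op (Joint H L)}

theorem validQTL_iff {φ : QTL (Joint H L)} :
    π.ValidQTL P φ ↔ ∀ σ ∈ States H L, Sat σ P → Models (fun i => π.step^[i] σ) φ := by
  refine ⟨fun h σ hσ hsat => h _ hσ hsat fun i => Function.iterate_succ_apply' _ _ _,
    fun h w hw hsat hstep => ?_⟩
  have hiter : w = fun i => π.step^[i] (w 0) := by
    funext i
    induction i with
    | zero => rfl
    | succ i ih => rw [hstep, ih, Function.iterate_succ_apply']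
  rw [hiter]
  exact h _ hw hsat

theorem comap_M₀_comap_M₀ : (q.comap π.M₀).comap π.M₀ = q.comap π.M₀ := by
  classical
  ext ψ
  exact (congrArg (· ∈ q) (π.M₀_eq_self (π.M₀_mem_exitSpace ψ))).to_iff

theorem step_sandwich_M₀ (hσ : σ ∈ PartialDensity (Joint H L)) :
    π.step (sandwich π.M₀ σ) = sandwich π.M₀ σ := by
  classical
  have hM₀₁ : π.M₁ ∘L π.M₀ = 0 := ext fun ψ => π.mem_exitSpace.1 (π.M₀_mem_exitSpace ψ)
  have hM₀₀ : π.M₀ ∘L π.M₀ = π.M₀ := ext fun ψ => π.M₀_eq_self (π.M₀_mem_exitSpace ψ)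
  rw [π.step_eq ((isOperation_sandwich π.isQuantumLoop.norm_exit_le).mem_partialDensity hσ),
    loopStep, sandwich_sandwich, sandwich_sandwich, hM₀₁, hM₀₀, sandwich_zero_left,
    π.isOperation_step.map_zero, zero_add]

variable [DecidableEq L]

theorem comap_M₀_exitSpace_inf : (π.exitSpace ⊓ q).comap π.M₀ = q.comap π.M₀ := by
  ext ψ
  exact ⟨fun h => h.2, fun h => ⟨π.M₀_mem_exitSpace ψ, h⟩⟩

theorem comap_M₀_eq_of_runSpace_le (hq : q ∈ AP H L) (h : π.runSpace ≤ q) :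
    q.comap π.M₀ = q := by
  refine le_antisymm (fun ψ hψ => ?_) (π.le_comap_M₀ hq)
  rw [← π.M₀_add_M₁ ψ]
  exact add_mem hψ (h (π.M₁_mem_runSpace ψ))

/-- The part of the state that has already left the loop after `n` rounds. -/
def exited (σ : Op (Joint H L)) (n : ℕ) : Op (Joint H L) :=
  ∑ m ∈ Finset.range n, sandwich π.M₀ ((loopStep π.M₁ π.step)^[m] σ)

theorem isTraceClass_exited (hσ : IsTraceClass σ) (n : ℕ) : IsTraceClass (π.exited σ n) :=
  .sum (π.isQuantumLoop.isTraceClass_exit hσ)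

theorem step_exited (hσ : σ ∈ PartialDensity (Joint H L)) (n : ℕ) :
    π.step (π.exited σ n) = π.exited σ n := by
  have hσ' := isTraceClass_of_mem hσ
  induction n with
  | zero => exact π.isOperation_step.map_zero
  | succ n ih =>
    rw [exited, Finset.sum_range_succ, ← exited, π.isOperation_step.map_add
      (π.isTraceClass_exited hσ' n) (π.isQuantumLoop.isTraceClass_exit hσ' n), ih,
      π.step_sandwich_M₀ ((π.isQuantumLoop.isOperation_loopStep.iterate n).mem_partialDensity hσ)]

theorem iterate_step_eq (hσ : σ ∈ PartialDensity (Joint H L)) (n : ℕ) :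
    π.step^[n] σ = (loopStep π.M₁ π.step)^[n] σ + π.exited σ n := by
  have hσ' := isTraceClass_of_mem hσ
  induction n with
  | zero => simp [exited]
  | succ n ih =>
    have hn := (π.isQuantumLoop.isOperation_loopStep.iterate n).mem_partialDensity hσ
    rw [Function.iterate_succ_apply', ih, π.isOperation_step.map_add (isTraceClass_of_mem hn)
      (π.isTraceClass_exited hσ' n), π.step_exited hσ, π.step_eq hn, Function.iterate_succ_apply',
      exited, exited, Finset.sum_range_succ]
    abel

theorem forall_sat_iterate_step_iff (hσ : σ ∈ PartialDensity (Joint H L)) :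
    (∀ n, Sat (π.step^[n] σ) (q.comap π.M₀)) ↔ Sat (denote π.whileForm σ) q := by
  have hσ' := isTraceClass_of_mem hσ
  have htc := π.isQuantumLoop.isTraceClass_iterate hσ'
  rw [whileForm, body, π.isQuantumLoop.sat_denote_iff hσ']
  simp only [π.iterate_step_eq hσ, (htc _).sat_add_iff (π.isTraceClass_exited hσ' _)]
  simp only [exited, IsTraceClass.sat_sum_iff (π.isQuantumLoop.isTraceClass_exit hσ'),
    (htc _).sat_sandwich_iff, comap_M₀_comap_M₀]
  exact ⟨fun h n => (h n).1, fun h n => ⟨h n, fun m _ => h m⟩⟩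

theorem validQTL_always_iff (hP : P ∈ AP H L) :
    π.ValidQTL P (.always (.atom (q.comap π.M₀))) ↔ P ≤ π.isOperation_denote.wlp q := by
  rw [validQTL_iff, ← forall_states_sat_iff_le hP]
  refine forall₂_congr fun σ hσ => imp_congr_right fun _ => ?_
  have hσ' := (mem_partialDensity_of_mem_states hσ).1
  rw [π.isOperation_denote.sat_wlp_iff (isTraceClass_of_mem hσ'),
    ← π.forall_sat_iterate_step_iff hσ']
  simp only [Models, zero_add]

theorem proj_exitSpace_inf_comp_M₀ :
    proj (π.exitSpace ⊓ q) ∘L π.M₀ = proj (π.exitSpace ⊓ q) := by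
  refine ContinuousLinearMap.ext fun ψ => ?_
  have horth : π.M₁ ψ ∈ (π.exitSpace ⊓ q).toSubmoduleᗮ := by
    refine (Submodule.mem_orthogonal _ _).2 fun u hu => ?_
    rw [← π.M₀_eq_self hu.1, PiLp.inner_apply]
    refine Finset.sum_eq_zero fun l _ => ?_
    change ⟪bra l (π.M₀ u), bra l (π.M₁ ψ)⟫_ℂ = 0
    rw [bra_M₀, bra_M₁]
    split_ifs <;> simp
  conv_rhs => rw [← π.M₀_add_M₁ ψ, map_add, proj_apply_eq_zero_iff.2 horth, add_zero]
  rfl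

theorem trace_iterate_step_comp_proj (hσ : σ ∈ PartialDensity (Joint H L)) (n : ℕ) :
    (trace (π.step^[n] σ ∘L proj (π.exitSpace ⊓ q))).re = ∑ m ∈ Finset.range (n + 1),
      (trace (sandwich π.M₀ ((loopStep π.M₁ π.step)^[m] σ) ∘L proj (π.exitSpace ⊓ q))).re := by
  have hσ' := isTraceClass_of_mem hσ
  have htc := π.isQuantumLoop.isTraceClass_iterate hσ'
  have hexit := π.isQuantumLoop.isTraceClass_exit hσ'
  have hlast : trace ((loopStep π.M₁ π.step)^[n] σ ∘L proj (π.exitSpace ⊓ q)) =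
      trace (sandwich π.M₀ ((loopStep π.M₁ π.step)^[n] σ) ∘L proj (π.exitSpace ⊓ q)) := by
    rw [(htc n).trace_comp_proj, (hexit n).trace_comp_proj, sandwich_sandwich,
      proj_exitSpace_inf_comp_M₀]
  rw [π.iterate_step_eq hσ, (htc n).trace_comp_add (π.isTraceClass_exited hσ' n), exited,
    IsTraceClass.trace_comp_sum hexit, hlast, add_comm, ← Finset.sum_range_succ, Complex.re_sum]

theorem almostEventually_iff (hσ : σ ∈ PartialDensity (Joint H L)) (h1 : trace σ = 1) :
    Models (fun n => π.step^[n] σ) (.almostEventually (π.exitSpace ⊓ q)) ↔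
      Sat (denote π.whileForm σ) q ∧ trace (denote π.whileForm σ) = trace σ := by
  have hσ' := isTraceClass_of_mem hσ
  have hden := π.isOperation_denote.isTraceClass hσ'
  have hsum := π.isQuantumLoop.hasSum_trace_exit_comp hσ' (proj (π.exitSpace ⊓ q))
  have hsat : Sat (denote π.whileForm σ) (π.exitSpace ⊓ q) ↔ Sat (denote π.whileForm σ) q := by
    simp only [whileForm, body, π.isQuantumLoop.sat_denote_iff hσ', comap_M₀_exitSpace_inf]
  have hle := hden.trace_comp_proj_le (π.exitSpace ⊓ q)
  have hle' := π.isOperation_denote.trace_le hσ'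
  simp only [Models, π.trace_iterate_step_comp_proj hσ]
  rw [← hsat, ← hden.trace_comp_proj_eq_iff, hσ'.trace_eq_iff hden,
    forall_exists_lt_sum_range_iff (fun n => (π.isQuantumLoop.isTraceClass_exit hσ'
      n).trace_comp_proj_nonneg _) hsum]
  rw [h1, Complex.one_re] at hle' ⊢
  exact ⟨fun h => ⟨hle.antisymm (hle'.trans h), hle'.antisymm (h.trans hle)⟩,
    fun h => (h.1.trans h.2).ge⟩

theorem validQTL_almostEventually_iff (hP : P ∈ AP H L) :
    π.ValidQTL P (.almostEventually (π.exitSpace ⊓ q)) ↔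
      P ≤ π.isOperation_denote.wlp q ⊓ π.isOperation_denote.losslessSpace := by
  rw [validQTL_iff, ← forall_states_sat_iff_le hP]
  refine forall₂_congr fun σ hσ => imp_congr_right fun _ => ?_
  obtain ⟨hσ', h1⟩ := mem_partialDensity_of_mem_states hσ
  rw [π.almostEventually_iff hσ' h1,
    ← π.isOperation_denote.sat_wlp_iff (isTraceClass_of_mem hσ'),
    ← π.isOperation_denote.sat_losslessSpace_iff (isTraceClass_of_mem hσ')]
  exact le_inf_iff.symm

end ExitProgram

end QTLogic

end

open QTLogic in
theorem mainTheorem12_general {H : Type*} [NormedAddCommGroup H] [InnerProductSpace ℂ H]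
    [CompleteSpace H] {L : Type*} [Fintype L] [DecidableEq L] (π : ExitProgram H L)
    (P q : ClosedSubmodule ℂ (Joint H L)) (hP : P ∈ AP H L) (hq : q ∈ AP H L) :
    ((π.ProvesPar π.whileForm P q ↔ ValidPar π.whileForm P q) ∧
      (π.ProvesPar π.whileForm P q ↔
        π.ValidQTL P (.always (.atom (π.runSpace ⊔ (π.exitSpace ⊓ q))))) ∧
      (π.runSpace ≤ q →
        (π.ProvesPar π.whileForm P q ↔ π.ValidQTL P (.always (.atom q))))) ∧
    ((π.ProvesTot π.whileForm P q ↔ ValidTot π.whileForm P q) ∧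
      (π.ProvesTot π.whileForm P q ↔
        π.ValidQTL P (.almostEventually (π.exitSpace ⊓ q))) ∧
      (q ≤ π.exitSpace →
        (π.ProvesTot π.whileForm P q ↔ π.ValidQTL P (.almostEventually q)))) := by
  have hPar : π.ProvesPar π.whileForm P q ↔ π.ValidQTL P (.always (.atom (q.comap π.M₀))) :=
    (π.provesPar_iff_le_wlp hP hq).trans (π.validQTL_always_iff hP).symm
  have hTot : π.ProvesTot π.whileForm P q ↔
      π.ValidQTL P (.almostEventually (π.exitSpace ⊓ q)) :=
    (π.provesTot_iff_le_wlp_inf hP hq).trans (π.validQTL_almostEventually_iff hP).symm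
  refine ⟨⟨(π.provesPar_iff_le_wlp hP hq).trans (validPar_iff_le_wlp π.isOperation_denote).symm,
      ?_, fun h => ?_⟩,
    (π.provesTot_iff_le_wlp_inf hP hq).trans (validTot_iff_le_wlp_inf π.isOperation_denote).symm,
      hTot, fun h => ?_⟩
  · rwa [π.runSpace_sup_eq]
  · rwa [π.comap_M₀_eq_of_runSpace_le hq h] at hPar
  · rwa [inf_eq_right.2 h] at hTot

open QTLogic in
theorem mainTheorem12 {H : Type*} [NormedAddCommGroup H] [InnerProductSpace ℂ H]
    [CompleteSpace H] [TopologicalSpace.SeparableSpace H]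
    {L : Type*} [Fintype L] [DecidableEq L] (π : ExitProgram H L)
    (P q : ClosedSubmodule ℂ (Joint H L)) (hP : P ∈ AP H L) (hq : q ∈ AP H L) :
    ((π.ProvesPar π.whileForm P q ↔ ValidPar π.whileForm P q) ∧
      (π.ProvesPar π.whileForm P q ↔
        π.ValidQTL P (.always (.atom (π.runSpace ⊔ (π.exitSpace ⊓ q))))) ∧
      (π.runSpace ≤ q →
        (π.ProvesPar π.whileForm P q ↔ π.ValidQTL P (.always (.atom q))))) ∧
    ((π.ProvesTot π.whileForm P q ↔ ValidTot π.whileForm P q) ∧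
      (π.ProvesTot π.whileForm P q ↔
        π.ValidQTL P (.almostEventually (π.exitSpace ⊓ q))) ∧
      (q ≤ π.exitSpace →
        (π.ProvesTot π.whileForm P q ↔ π.ValidQTL P (.almostEventually q)))) :=
  mainTheorem12_general π P q hP hq
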